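/- Let $A,B\in\mathbb R\setminus\{0\}$, let $n,m,p,q\in\mathbb Z$ satisfy $nq-mp=1$, and put $$b=\sqrt{n^2A^2+m^2B^2},\quad a=\frac{(qn-pm)AB}{b},\quad \Xi_0=\frac1b(nA,mB),\quad \Xi_0^\perp=\frac1b(-mB,nA).$$ Let $F:\mathbb R^2\to\mathbb R^2$ be the orthogonal change of coordinates $F(x,y)=x\,\Xi_0^\perp+y\,\Xi_0$. Let $V\in C^\infty(\mathbb R^2)$ (complex valued, in particular possibly real valued) be periodic with respect to $A\mathbb Z\times B\mathbb Z$, and let $\chi\in C_c^\infty(\mathbb R^2)$, $\chi=\chi(\xi,\eta)$, vanish in a neighbourhood of the line $\{\eta=0\}$. Put $$V_0(x)=\frac1b\int_0^b (F^*V)(x,y)\,dy .$$ Conventions. $D=-i\partial$, and $0<h\le 1$. All operators are continuous linear maps of the space $\mathcal S'(\mathbb R^2)$ of tempered distributions (weak-* topology) to itself. For a symbol $c(x,y,\xi,\eta;h)$, the operator $c(x,y,hD_x,hD_y;h)$ is given on Schwartz functions by the left quantization $$ f\mapsto (2\pi h)^{-2}\iint e^{i\langle z-z',\zeta\rangle/h}c(z,\zeta;h)f(z')\,dz'\,d\zeta.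 $$ $\Psi^0(\mathbb R^2)$ is the set of the families of operators $c(z,hD;h)$, $0<h\le1$, with $c$ smooth in $(z,\zeta)$ and $|\partial_z^\alpha\partial_\zeta^\beta c(z,\zeta;h)|\le C_{\alpha\beta}(1+|\zeta|)^{-|\beta|}$, $C_{\alpha\beta}$ independent of $z,\zeta,h$. $C^\infty(\mathbb R)\otimes\Psi^0(\mathbb R)$ is understood as the set of the families $Q(x,y,hD_y)$ with a smooth symbol $Q(x,y,\eta)$, independent of $h$, satisfying $|\partial_{x,y}^\alpha\partial_\eta^k Q(x,y,\eta)|\le C_{\alpha k}(1+|\eta|)^{-k}$ uniformly. An operator preserves $A\mathbb Z\times B\mathbb Z$ periodicity if it maps $A\mathbb Z\times B\mathbb Z$ periodic tempered distributions to $A\mathbb Z\times B\mathbb Z$ periodic ones. Then $V_0(x+ka)=V_0(x)$ for all $x\in\mathbb R$ and $k\in\mathbb Z$, and there exists $Q=Q(x,y,hD_y)\in C^\infty(\mathbb R)\otimes\Psi^0(\mathbb R)$ such that $(F^{-1})^*QF^*$ preserves $A\mathbb Z\times B\mathbb Z$ periodicity for every $0<h\le1$ and the following hold. (i) There exists $R\in\Psi^0(\mathbb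 R^2)$ such that $(F^{-1})^*RF^*$ preserves $A\mathbb Z\times B\mathbb Z$ periodicity and, for all $0<h\le 1$, $$(I+hQ)\bigl(D_y^2+F^*V(x,y)\bigr)\chi(hD_x,hD_y)=\bigl(D_y^2+V_0(x)\bigr)(I+hQ)\chi(hD_x,hD_y)+hR .$$ (ii) There exist $W=W(x,y,hD_x,hD_y)\in\Psi^0(\mathbb R^2)$, with a symbol independent of $h$ that satisfies $W(x,y,0,\eta)\equiv0$, and $R\in\Psi^0(\mathbb R^2)$ such that $(F^{-1})^*WF^*$ and $(F^{-1})^*RF^*$ preserve $A\mathbb Z\times B\mathbb Z$ periodicity and, for all $0<h\le1$, $$(I+hQ)\bigl(D_x^2+D_y^2+F^*V(x,y)\bigr)\chi(hD_x,hD_y)=\Bigl(\bigl(D_x^2+D_y^2+V_0(x)\bigr)(I+hQ)+W\Bigr)\chi(hD_x,hD_y)+hR .$$ -/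

import Mathlib

open scoped SchwartzMap ContDiff Topology FourierTransform

/-- The plane `ℝ²` with its Euclidean structure; `z 0` and `z 1` are the coordinates. -/
abbrev Plane : Type := EuclideanSpace ℝ (Fin 2)

/-- Operators: continuous linear maps of the space `𝓢'(ℝ²)` of tempered distributions
(with the weak-* topology) to itself. -/
abbrev PlaneOp : Type := 𝓢'(Plane, ℂ) →L[ℂ] 𝓢'(Plane, ℂ)

noncomputable section

/-! ### Symbols and semiclassical quantization -/

/-- `h`-dependent symbols of order `0`: for `0 < h ≤ 1` the function `a h` is smooth and
`|∂_z^j ∂_ζ^k a(z, ζ; h)| ≤ C_{jk} (1 + |ζ|)^{-k}`, uniformly in `z`, `ζ` and `h`. -/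
structure IsSymbolZero {X E : Type*} [NormedAddCommGroup X] [NormedSpace ℝ X]
    [NormedAddCommGroup E] [NormedSpace ℝ E] (a : ℝ → X → E → ℂ) : Prop where
  smooth : ∀ h ∈ Set.Ioc (0 : ℝ) 1, ContDiff ℝ ∞ (fun p : X × E ↦ a h p.1 p.2)
  bound : ∀ j k : ℕ, ∃ C : ℝ, ∀ h ∈ Set.Ioc (0 : ℝ) 1, ∀ (z : X) (ζ : E),
    (1 + ‖ζ‖) ^ k *
      ‖iteratedFDeriv ℝ k (fun ζ' ↦ iteratedFDeriv ℝ j (fun z' ↦ a h z' ζ') z) ζ‖ ≤ C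

/-- `T = a(z, hD)`: the operator `T` acts on Schwartz functions by the standard (left) quantization
`(T f)(z) = (2πh)⁻² ∬ e^{i⟨z - z', ζ⟩/h} a(z, ζ) f(z') dz' dζ
          = ∫ e^{2πi⟨w, z⟩} a(z, 2πh w) 𝓕f(w) dw`,
where `𝓕f(w) = ∫ e^{-2πi⟨z', w⟩} f(z') dz'`. Since Schwartz functions are dense in the tempered
distributions and `T` is continuous, this determines `T`. -/
def IsQuantization (h : ℝ) (a : Plane → Plane → ℂ) (T : PlaneOp) : Prop :=
  ∀ f φ : 𝓢(Plane, ℂ),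
    T (f : 𝓢'(Plane, ℂ)) φ =
      ∫ z : Plane, φ z * ∫ w : Plane,
        Complex.exp (2 * Real.pi * Complex.I * (inner ℝ w z : ℝ)) *
          a z ((2 * Real.pi * h) • w) * (𝓕 f : 𝓢(Plane, ℂ)) w

/-- `T ∈ Ψ⁰(ℝ²)`: a family `T h = a(z, hD; h)`, `0 < h ≤ 1`, with a symbol of order `0`. -/
def IsPsiZero (T : ℝ → PlaneOp) : Prop :=
  ∃ a : ℝ → Plane → Plane → ℂ, IsSymbolZero a ∧
    ∀ h ∈ Set.Ioc (0 : ℝ) 1, IsQuantization h (a h) (T h)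

/-- `T ∈ C^∞(ℝ_x) ⊗ Ψ⁰(ℝ_y)`: a family `T h = q(x, y, hD_y)`, `0 < h ≤ 1`, where the symbol
`q(x, y, η)` is of order `0` with respect to `η` and does not depend on `ξ`. -/
def IsTangentialPsiZero (T : ℝ → PlaneOp) : Prop :=
  ∃ q : Plane → ℝ → ℂ, IsSymbolZero (fun _ : ℝ ↦ q) ∧
    ∀ h ∈ Set.Ioc (0 : ℝ) 1, IsQuantization h (fun z ζ ↦ q z (ζ 1)) (T h)

/-- `T = W(z, hD)` for `0 < h ≤ 1`, with a symbol `W(x, y, ξ, η)` of order `0` (not depending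
on `h`) that vanishes identically on `ξ = 0`. -/
def IsPsiZeroVanishing (T : ℝ → PlaneOp) : Prop :=
  ∃ w : Plane → Plane → ℂ, IsSymbolZero (fun _ : ℝ ↦ w) ∧
    (∀ h ∈ Set.Ioc (0 : ℝ) 1, IsQuantization h w (T h)) ∧
    ∀ z ζ : Plane, ζ 0 = 0 → w z ζ = 0

/-- The Fourier multiplier `χ(hD_x, hD_y)`. -/
def cutoffOp (χ : Plane → ℂ) (h : ℝ) : PlaneOp :=
  TemperedDistribution.fourierMultiplierCLM ℂ (fun w : Plane ↦ χ ((2 * Real.pi * h) • w))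

/-- `D_x` for `i = 0` and `D_y` for `i = 1`, where `D = -i ∂`. -/
def diffD (i : Fin 2) : PlaneOp :=
  (-Complex.I) • LineDeriv.lineDerivOpCLM ℂ 𝓢'(Plane, ℂ) (EuclideanSpace.single i (1 : ℝ))

/-- Multiplication by a smooth function of temperate growth. -/
def mulOp (g : Plane → ℂ) : PlaneOp := TemperedDistribution.smulLeftCLM ℂ g

/-! ### The torus and the coordinates adapted to a rational direction -/

/-- The element `(jA, kB)` of the lattice `Aℤ × Bℤ`. -/
def latticeVec (A B : ℝ) (j k : ℤ) : Plane := !₂[(j : ℝ) * A, (k : ℝ) * B]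

/-- Periodicity of a tempered distribution with respect to `Aℤ × Bℤ`. -/
def IsPeriodicDistribution (A B : ℝ) (u : 𝓢'(Plane, ℂ)) : Prop :=
  ∀ (j k : ℤ) (φ : 𝓢(Plane, ℂ)), u (φ.compSubConstCLM ℂ (latticeVec A B j k)) = u φ

/-- `T` maps `Aℤ × Bℤ` periodic distributions to `Aℤ × Bℤ` periodic distributions. -/
def PreservesPeriodicity (A B : ℝ) (T : PlaneOp) : Prop :=
  ∀ u, IsPeriodicDistribution A B u → IsPeriodicDistribution A B (T u)

/-- The pullback `G^* u = u ∘ G` of tempered distributions by an orthogonal map `G`: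
`⟨G^* u, φ⟩ = ⟨u, φ ∘ G⁻¹⟩`. -/
def pullbackOp (G : Plane ≃ₗᵢ[ℝ] Plane) : PlaneOp :=
  PointwiseConvergenceCLM.precomp ℂ
    (SchwartzMap.compCLMOfContinuousLinearEquiv ℂ G.symm.toContinuousLinearEquiv)

/-- The operator `(F⁻¹)^* T F^*`. -/
def conjOp (F : Plane ≃ₗᵢ[ℝ] Plane) (T : PlaneOp) : PlaneOp :=
  pullbackOp F.symm ∘L T ∘L pullbackOp F

/-- `b = √(n²A² + m²B²)`. -/
def bLength (A B : ℝ) (n m : ℤ) : ℝ := √((n : ℝ) ^ 2 * A ^ 2 + (m : ℝ) ^ 2 * B ^ 2)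

/-- `a = (qn - pm)AB / √(n²A² + m²B²)`. -/
def aLength (A B : ℝ) (n m p q : ℤ) : ℝ :=
  ((q : ℝ) * n - (p : ℝ) * m) * A * B / bLength A B n m

/-- The rational direction `Ξ₀ = (nA, mB) / √(n²A² + m²B²)`. -/
def xiZero (A B : ℝ) (n m : ℤ) : Plane := (bLength A B n m)⁻¹ • !₂[(n : ℝ) * A, (m : ℝ) * B]

/-- `Ξ₀^⊥ = (-mB, nA) / √(n²A² + m²B²)`. -/
def xiPerp (A B : ℝ) (n m : ℤ) : Plane := (bLength A B n m)⁻¹ • !₂[-((m : ℝ) * B), (n : ℝ) * A]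

/-- `F` is the change of coordinates `F(x, y) = x Ξ₀^⊥ + y Ξ₀`, which is orthogonal
(see `exists_isAdapted`). -/
def IsAdapted (A B : ℝ) (n m : ℤ) (F : Plane ≃ₗᵢ[ℝ] Plane) : Prop :=
  ∀ x y : ℝ, F !₂[x, y] = x • xiPerp A B n m + y • xiZero A B n m

/-- `V₀(x) = b⁻¹ ∫₀ᵇ (F^*V)(x, y) dy`. -/
def orbitAverage (b : ℝ) (F : Plane ≃ₗᵢ[ℝ] Plane) (V : Plane → ℂ) (x : ℝ) : ℂ :=
  (b : ℂ)⁻¹ * ∫ y in (0 : ℝ)..b, V (F !₂[x, y])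

theorem exists_isAdapted {A B : ℝ} (hA : A ≠ 0) (hB : B ≠ 0) {n m : ℤ} (hnm : n ≠ 0 ∨ m ≠ 0) :
    ∃ F : Plane ≃ₗᵢ[ℝ] Plane, IsAdapted A B n m F := by
  have hpos : 0 < (n : ℝ) ^ 2 * A ^ 2 + (m : ℝ) ^ 2 * B ^ 2 := by
    rcases hnm with h | h
    · have : (n : ℝ) ≠ 0 := by exact_mod_cast h
      positivity
    · have : (m : ℝ) ≠ 0 := by exact_mod_cast h
      positivity
  have hb : 0 < bLength A B n m := Real.sqrt_pos.2 hpos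
  have hb2 : bLength A B n m ^ 2 = (n : ℝ) ^ 2 * A ^ 2 + (m : ℝ) ^ 2 * B ^ 2 :=
    Real.sq_sqrt hpos.le
  let L : Plane →ₗ[ℝ] Plane :=
    { toFun := fun z ↦ z 0 • xiPerp A B n m + z 1 • xiZero A B n m
      map_add' := fun z w ↦ by simp [add_smul]; abel
      map_smul' := fun c z ↦ by simp [mul_smul] }
  have hL : ∀ z, ‖L z‖ = ‖z‖ := by
    intro z
    rw [EuclideanSpace.norm_eq, EuclideanSpace.norm_eq]
    congr 1
    simp only [L, LinearMap.coe_mk, AddHom.coe_mk, Fin.sum_univ_two, xiPerp, xiZero,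
      Real.norm_eq_abs, sq_abs, PiLp.add_apply, PiLp.smul_apply, smul_eq_mul,
      Matrix.cons_val_zero, Matrix.cons_val_one]
    field_simp
    rw [hb2]
    ring
  refine ⟨LinearIsometry.toLinearIsometryEquiv ⟨L, hL⟩ rfl, fun x y ↦ ?_⟩
  simp [L]

end

/-! This is one step of an averaging method. Put v = F^*V and look for Q = g(x,y) ψ(hD_y). Moving `I
+ hQ` past D_y² produces the commutator h[g, D_y²]ψ(hD_y) = -2 (D_y g) hD_y ψ(hD_y) - h (D_y² g)
ψ(hD_y). Since χ is supported away from η = 0, ψ can be chosen smooth, compactly supported and equal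
to 1/(2η) on supp χ. In front of χ(hD) the leading term is then -D_y g, and it cancels v - V₀ as
soon as D_y g = v - V₀. This equation is solvable with g periodic because v is b-periodic in y and
V₀ is its mean; an explicit solution is g = (i/b) ∫₀ᵇ s v(x, y+s) ds (`fderiv_shiftAverage_ofReal`).
Everything else carries a factor h.

For D_x² the same commutator leaves -2 (D_x g) hD_x ψ(hD_y), which nothing cancels. It has size 1
but vanishes at ξ = 0; with ξ truncated outside supp χ, it is W.

The algebra is exact (`conjugate_sq`, `conjugate_potential`). The only composition not already in
left-quantized form is ψ(hD_y)v, whose symbol is an explicit integral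
(`hasPointwiseSymbol_cutoffOp_comp_mulOp`), so no asymptotic expansion is needed. Periodicity is
preserved because every factor commutes with the translations of the lattice pulled back by F. -/

open MeasureTheory

/-! ### Differentiation under the integral sign. -/

section ParametricIntegral

variable {E G : Type*} [NormedAddCommGroup E] [NormedSpace ℝ E]
  [NormedAddCommGroup G] [NormedSpace ℝ G]

theorem ContDiff.section_right {Φ : ℝ → E → G}
    (hΦ : ContDiff ℝ ∞ (Function.uncurry Φ)) (t : ℝ) : ContDiff ℝ ∞ (Φ t) :=
  hΦ.comp (contDiff_prodMk_right t)

theorem ContDiff.uncurry_fderiv_section {Φ : ℝ → E → G}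
    (hΦ : ContDiff ℝ ∞ (Function.uncurry Φ)) :
    ContDiff ℝ ∞ (Function.uncurry fun t ↦ fderiv ℝ (Φ t)) := by
  have h : ContDiff ℝ ∞ (Function.uncurry fun (p : ℝ × E) (x : E) ↦ Φ p.1 x) :=
    hΦ.comp (by fun_prop : ContDiff ℝ ∞ fun q : (ℝ × E) × E ↦ (q.1.1, q.2))
  exact ContDiff.fderiv h contDiff_snd (by simp)

theorem hasFDerivAt_integral_of_contDiff {μ : Measure ℝ} {Φ : ℝ → E → G}
    (hΦ : ContDiff ℝ ∞ (Function.uncurry Φ)) {β β' : ℝ → ℝ} (hβ : Integrable β μ)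
    (hβ' : Integrable β' μ) (hb : ∀ᵐ t ∂μ, ∀ x, ‖Φ t x‖ ≤ β t)
    (hb' : ∀ᵐ t ∂μ, ∀ x, ‖fderiv ℝ (Φ t) x‖ ≤ β' t) (x : E) :
    HasFDerivAt (fun x ↦ ∫ t, Φ t x ∂μ) (∫ t, fderiv ℝ (Φ t) x ∂μ) x := by
  have hmeas : ∀ x, AEStronglyMeasurable (fun t ↦ Φ t x) μ := fun x ↦
    (hΦ.continuous.comp (by fun_prop : Continuous fun t : ℝ ↦ (t, x))).aestronglyMeasurable
  have hmeas' : AEStronglyMeasurable (fun t ↦ fderiv ℝ (Φ t) x) μ :=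
    (hΦ.uncurry_fderiv_section.continuous.comp
      (by fun_prop : Continuous fun t : ℝ ↦ (t, x))).aestronglyMeasurable
  exact hasFDerivAt_integral_of_dominated_of_fderiv_le (bound := β')
    (F' := fun x t ↦ fderiv ℝ (Φ t) x) Filter.univ_mem
    (Filter.Eventually.of_forall hmeas)
    (hβ.mono' (hmeas x) (hb.mono fun t ht ↦ ht x)) hmeas' (hb'.mono fun t ht x _ ↦ ht x) hβ'
    (Filter.Eventually.of_forall fun t x _ ↦
      (((hΦ.section_right t).differentiable (by simp)) x).hasFDerivAt)

end ParametricIntegral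

section ParametricIntegralIterated

/-- Differentiation under the integral sign, to all orders. -/
theorem contDiff_integral_and_norm_iteratedFDeriv_le {E : Type} [NormedAddCommGroup E]
    [NormedSpace ℝ E] {μ : Measure ℝ} (k : ℕ) :
    ∀ {G : Type} [NormedAddCommGroup G] [NormedSpace ℝ G] {Φ : ℝ → E → G} {β : ℕ → ℝ → ℝ},
      ContDiff ℝ ∞ (Function.uncurry Φ) → (∀ j, Integrable (β j) μ) →
      (∀ j, ∀ᵐ t ∂μ, ∀ x, ‖iteratedFDeriv ℝ j (Φ t) x‖ ≤ β j t) →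
      ContDiff ℝ k (fun x ↦ ∫ t, Φ t x ∂μ) ∧
        ∀ x, ‖iteratedFDeriv ℝ k (fun x ↦ ∫ t, Φ t x ∂μ) x‖ ≤ ∫ t, β k t ∂μ := by
  -- The target `G` is quantified inside the induction, since the step applies the hypothesis to
  -- `fderiv`, with values in `E →L[ℝ] G`; `Type` keeps this space in the same universe.
  induction k with
  | zero =>
    intro G _ _ Φ β hΦ hβ hb
    refine ⟨contDiff_zero.2 (continuous_iff_continuousAt.2 fun x ↦
      (hasFDerivAt_integral_of_contDiff hΦ (hβ 0) (hβ 1) (by simpa using hb 0)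
        (by simpa using hb 1) x).continuousAt), fun x ↦ ?_⟩
    rw [norm_iteratedFDeriv_zero]
    exact norm_integral_le_of_norm_le (hβ 0) ((hb 0).mono fun t ht ↦ by simpa using ht x)
  | succ k ih =>
    intro G _ _ Φ β hΦ hβ hb
    have hd : ∀ x, HasFDerivAt (fun x ↦ ∫ t, Φ t x ∂μ) (∫ t, fderiv ℝ (Φ t) x ∂μ) x :=
      hasFDerivAt_integral_of_contDiff hΦ (hβ 0) (hβ 1) (by simpa using hb 0) (by simpa using hb 1)
    have hf : fderiv ℝ (fun x ↦ ∫ t, Φ t x ∂μ) = fun x ↦ ∫ t, fderiv ℝ (Φ t) x ∂μ :=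
      funext fun x ↦ (hd x).fderiv
    obtain ⟨h1, h2⟩ := ih (β := fun j ↦ β (j + 1)) hΦ.uncurry_fderiv_section
      (fun j ↦ hβ (j + 1)) fun j ↦ (hb (j + 1)).mono fun t ht x ↦ by
        rw [norm_iteratedFDeriv_fderiv]; exact ht x
    refine ⟨?_, fun x ↦ ?_⟩
    · rw [Nat.cast_succ, contDiff_succ_iff_fderiv]
      refine ⟨fun x ↦ (hd x).differentiableAt, by simp, ?_⟩
      rw [hf]
      exact h1
    · rw [← norm_iteratedFDeriv_fderiv, hf]
      exact h2 x

end ParametricIntegralIterated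

/-! ### Families of functions with uniformly bounded derivatives. -/

section UniformBounds

variable {ι κ E E' G G' : Type*} [NormedAddCommGroup E] [NormedSpace ℝ E]
  [NormedAddCommGroup E'] [NormedSpace ℝ E'] [NormedAddCommGroup G] [NormedSpace ℝ G]
  [NormedAddCommGroup G'] [NormedSpace ℝ G']

/-- Currying is an isometry, so each inner derivative can be traded for an outer one. -/
theorem norm_iteratedFDeriv_iteratedFDeriv (f : E → G) (j : ℕ) :
    ∀ (k : ℕ) (x : E),
      ‖iteratedFDeriv ℝ k (iteratedFDeriv ℝ j f) x‖ = ‖iteratedFDeriv ℝ (k + j) f x‖ := by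
  induction j with
  | zero =>
    intro k x
    rw [iteratedFDeriv_zero_eq_comp, LinearIsometryEquiv.norm_iteratedFDeriv_comp_left]
    rfl
  | succ j ih =>
    intro k x
    rw [iteratedFDeriv_succ_eq_comp_left]
    refine (LinearIsometryEquiv.norm_iteratedFDeriv_comp_left (𝕜 := ℝ) (E := E)
      (G := E [×(j + 1)]→L[ℝ] G) (F := E →L[ℝ] E [×j]→L[ℝ] G) _ _ _ _).trans ?_
    rw [norm_iteratedFDeriv_fderiv, ih, add_right_comm, add_assoc]

/-- Families of smooth functions whose derivatives of each order are bounded, uniformly over the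
family. -/
def UnifBddDerivs (a : ι → E → G) : Prop :=
  (∀ i, ContDiff ℝ ∞ (a i)) ∧ ∀ k : ℕ, ∃ C : ℝ, ∀ i x, ‖iteratedFDeriv ℝ k (a i) x‖ ≤ C

namespace UnifBddDerivs

theorem contDiff {a : ι → E → G} (ha : UnifBddDerivs a) (i : ι) : ContDiff ℝ ∞ (a i) := ha.1 i

theorem exists_nonneg_bound {a : ι → E → G} (ha : UnifBddDerivs a) (k : ℕ) :
    ∃ C : ℝ, 0 ≤ C ∧ ∀ i x, ‖iteratedFDeriv ℝ k (a i) x‖ ≤ C := by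
  obtain ⟨C, hC⟩ := ha.2 k
  exact ⟨|C|, abs_nonneg C, fun i x ↦ (hC i x).trans (le_abs_self C)⟩

theorem hasTemperateGrowth {a : ι → E → G} (ha : UnifBddDerivs a) (i : ι) :
    (a i).HasTemperateGrowth := by
  refine ⟨ha.1 i, fun k ↦ ?_⟩
  obtain ⟨C, hC⟩ := ha.2 k
  exact ⟨0, C, fun x ↦ by simpa using hC i x⟩

theorem exists_norm_le {a : ι → E → G} (ha : UnifBddDerivs a) :
    ∃ C : ℝ, ∀ i x, ‖a i x‖ ≤ C := by
  obtain ⟨C, hC⟩ := ha.2 0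
  exact ⟨C, fun i x ↦ by simpa using hC i x⟩

/-- The shifts `c i` may be unbounded, since sup bounds do not see translations. This is the source
of uniformity in h and t for v(z - hte). -/
theorem comp_affine {a : ι → E → G} (ha : UnifBddDerivs a) (σ : κ → ι) (c : κ → E)
    (L : κ → E' →L[ℝ] E) {M : ℝ} (hL : ∀ i, ‖L i‖ ≤ M) :
    UnifBddDerivs fun i (x : E') ↦ a (σ i) (c i + L i x) := by
  refine ⟨fun i ↦ (ha.1 _).comp (contDiff_const.add (L i).contDiff), fun k ↦ ?_⟩
  obtain ⟨C, hC0, hC⟩ := ha.exists_nonneg_bound k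
  refine ⟨C * M ^ k, fun i x ↦ ?_⟩
  have h1 : (fun x : E' ↦ a (σ i) (c i + L i x)) = (fun y ↦ a (σ i) (c i + y)) ∘ L i := rfl
  have h2 : ContDiff ℝ ∞ (fun y ↦ a (σ i) (c i + y)) :=
    (ha.1 _).comp (contDiff_const.add contDiff_id)
  beta_reduce
  rw [h1, ContinuousLinearMap.iteratedFDeriv_comp_right _ h2 x (by exact_mod_cast le_top),
    iteratedFDeriv_comp_add_left]
  refine (ContinuousMultilinearMap.norm_compContinuousLinearMap_le _ _).trans ?_
  rw [Finset.prod_const, Finset.card_univ, Fintype.card_fin]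
  gcongr
  · exact hC _ _
  · exact hL i

theorem clm_comp {a : ι → E → G} (ha : UnifBddDerivs a) (L : G →L[ℝ] G') :
    UnifBddDerivs fun i (x : E) ↦ L (a i x) := by
  refine ⟨fun i ↦ L.contDiff.comp (ha.1 i), fun k ↦ ?_⟩
  obtain ⟨C, hC⟩ := ha.2 k
  refine ⟨‖L‖ * C, fun i x ↦ ?_⟩
  refine (L.norm_iteratedFDeriv_comp_left (ha.1 i).contDiffAt (n := k)
    (by exact_mod_cast le_top)).trans ?_
  gcongr
  exact hC i x

theorem lineDeriv {a : ι → E → G} (ha : UnifBddDerivs a) (e : E) :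
    UnifBddDerivs fun i (x : E) ↦ fderiv ℝ (a i) x e := by
  have h : UnifBddDerivs fun i (x : E) ↦ fderiv ℝ (a i) x := by
    refine ⟨fun i ↦ (ha.1 i).fderiv_right (by simp), fun k ↦ ?_⟩
    obtain ⟨C, hC⟩ := ha.2 (k + 1)
    exact ⟨C, fun i x ↦ by rw [norm_iteratedFDeriv_fderiv]; exact hC i x⟩
  exact h.clm_comp (ContinuousLinearMap.apply ℝ G e)

theorem add {a b : ι → E → G} (ha : UnifBddDerivs a) (hb : UnifBddDerivs b) :
    UnifBddDerivs fun i (x : E) ↦ a i x + b i x := by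
  refine ⟨fun i ↦ (ha.1 i).add (hb.1 i), fun k ↦ ?_⟩
  obtain ⟨C, hC⟩ := ha.2 k
  obtain ⟨C', hC'⟩ := hb.2 k
  refine ⟨C + C', fun i x ↦ ?_⟩
  have h := iteratedFDeriv_add_apply (x := x)
    ((ha.1 i).of_le (m := k) (by exact_mod_cast le_top)).contDiffAt
    ((hb.1 i).of_le (m := k) (by exact_mod_cast le_top)).contDiffAt
  refine (congrArg norm h).le.trans ((norm_add_le _ _).trans ?_)
  gcongr
  exacts [hC i x, hC' i x]

theorem mul {a b : ι → E → ℂ} (ha : UnifBddDerivs a) (hb : UnifBddDerivs b) :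
    UnifBddDerivs fun i (x : E) ↦ a i x * b i x := by
  refine ⟨fun i ↦ (ha.1 i).mul (hb.1 i), fun k ↦ ?_⟩
  choose C hC0 hC using ha.exists_nonneg_bound
  choose C' hC0' hC' using hb.exists_nonneg_bound
  refine ⟨∑ j ∈ Finset.range (k + 1), (k.choose j : ℝ) * C j * C' (k - j), fun i x ↦ ?_⟩
  refine (norm_iteratedFDeriv_mul_le (ha.1 i) (hb.1 i) x (n := k)
    (by exact_mod_cast le_top)).trans ?_
  gcongr with j _
  · exact mul_nonneg (by positivity) (hC0 j)
  · exact hC j i x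
  · exact hC' _ i x

theorem const_mul {a : ι → E → ℂ} (ha : UnifBddDerivs a) (c : ℂ) :
    UnifBddDerivs fun i (x : E) ↦ c * a i x :=
  ha.clm_comp (c • ContinuousLinearMap.id ℝ ℂ)

theorem of_hasCompactSupport {f : E → G} (hf : ContDiff ℝ ∞ f) (hs : HasCompactSupport f) :
    UnifBddDerivs fun _ : ι ↦ f := by
  refine ⟨fun _ ↦ hf, fun k ↦ ?_⟩
  obtain ⟨C, hC⟩ := (hf.continuous_iteratedFDeriv (m := k)
    (by exact_mod_cast le_top)).bounded_above_of_compact_support (hs.iteratedFDeriv k)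
  exact ⟨C, fun _ ↦ hC⟩

theorem integral {ι E G : Type} [NormedAddCommGroup E] [NormedSpace ℝ E]
    [NormedAddCommGroup G] [NormedSpace ℝ G] {μ : Measure ℝ} {Φ : ι → ℝ → E → G}
    (hΦ : ∀ i, ContDiff ℝ ∞ (Function.uncurry (Φ i))) {β : ℕ → ℝ → ℝ}
    (hβ : ∀ k, Integrable (β k) μ)
    (hb : ∀ i k, ∀ᵐ t ∂μ, ∀ x, ‖iteratedFDeriv ℝ k (Φ i t) x‖ ≤ β k t) :
    UnifBddDerivs fun i x ↦ ∫ t, Φ i t x ∂μ := by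
  have h := fun i k ↦ contDiff_integral_and_norm_iteratedFDeriv_le k (hΦ i) hβ (hb i)
  exact ⟨fun i ↦ contDiff_infty.2 fun k ↦ (h i k).1, fun k ↦ ⟨∫ t, β k t ∂μ, fun i ↦ (h i k).2⟩⟩

/-- A family of symbols with bounded derivatives that vanishes for large frequencies is of
order `0`. -/
theorem isSymbolZero {a : ℝ → E → E' → ℂ}
    (ha : UnifBddDerivs fun (h : Set.Ioc (0 : ℝ) 1) (p : E × E') ↦ a h p.1 p.2) {M : ℝ}
    (hM : ∀ h ∈ Set.Ioc (0 : ℝ) 1, ∀ z ζ, M < ‖ζ‖ → a h z ζ = 0) : IsSymbolZero a := by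
  refine ⟨fun h hh ↦ ha.1 ⟨h, hh⟩, fun j k ↦ ?_⟩
  obtain ⟨C, hC0, hC⟩ := ha.exists_nonneg_bound (k + j)
  -- Derivatives in z alone are the full derivative with every slot restricted to the first factor,
  -- a fixed continuous linear operation.
  let P : ((E × E') [×j]→L[ℝ] ℂ) →L[ℝ] (E [×j]→L[ℝ] ℂ) :=
    ContinuousMultilinearMap.compContinuousLinearMapL (𝕜 := ℝ) (F := ℂ)
      (fun _ : Fin j ↦ ContinuousLinearMap.inl ℝ E E')
  have hpart : ∀ h ∈ Set.Ioc (0 : ℝ) 1, ∀ z ζ, iteratedFDeriv ℝ j (fun z' ↦ a h z' ζ) z =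
      P (iteratedFDeriv ℝ j (fun p : E × E' ↦ a h p.1 p.2) (z, ζ)) := by
    intro h hh z ζ
    set b : E × E' → ℂ := fun p ↦ a h p.1 p.2 with hb
    have h1 : (fun z' ↦ a h z' ζ) = (fun p ↦ b ((0, ζ) + p)) ∘ ContinuousLinearMap.inl ℝ E E' := by
      ext z'; simp [hb]
    have h2 : ContDiff ℝ ∞ (fun p ↦ b ((0, ζ) + p)) :=
      (ha.1 ⟨h, hh⟩).comp (contDiff_const.add contDiff_id)
    rw [h1, ContinuousLinearMap.iteratedFDeriv_comp_right _ h2 z (by exact_mod_cast le_top),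
      iteratedFDeriv_comp_add_left]
    simp [P]
  have hsmooth : ∀ h ∈ Set.Ioc (0 : ℝ) 1,
      ContDiff ℝ ∞ (iteratedFDeriv ℝ j (fun p : E × E' ↦ a h p.1 p.2)) := fun h hh ↦
    (ha.1 ⟨h, hh⟩).iteratedFDeriv_right (m := ∞) (by exact_mod_cast le_top)
  have hbd : ∀ h ∈ Set.Ioc (0 : ℝ) 1, ∀ z ζ,
      ‖iteratedFDeriv ℝ k (fun ζ' ↦ iteratedFDeriv ℝ j (fun z' ↦ a h z' ζ') z) ζ‖ ≤
        ‖P‖ * (C * ‖ContinuousLinearMap.inr ℝ E E'‖ ^ k) := by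
    intro h hh z ζ
    have h1 : (fun ζ' ↦ iteratedFDeriv ℝ j (fun z' ↦ a h z' ζ') z) =
        P ∘ ((fun p : E × E' ↦ iteratedFDeriv ℝ j (fun p : E × E' ↦ a h p.1 p.2) ((z, 0) + p)) ∘
          ContinuousLinearMap.inr ℝ E E') := by
      ext1 ζ'; rw [hpart h hh]; simp
    have h2 : ContDiff ℝ ∞ (fun p : E × E' ↦
        iteratedFDeriv ℝ j (fun p : E × E' ↦ a h p.1 p.2) ((z, 0) + p)) :=
      (hsmooth h hh).comp (contDiff_const.add contDiff_id)
    rw [h1]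
    refine (P.norm_iteratedFDeriv_comp_left (n := k) (N := ∞)
      (h2.comp (ContinuousLinearMap.contDiff _)).contDiffAt (by exact_mod_cast le_top)).trans ?_
    gcongr
    rw [ContinuousLinearMap.iteratedFDeriv_comp_right _ h2 ζ (by exact_mod_cast le_top),
      iteratedFDeriv_comp_add_left]
    refine (ContinuousMultilinearMap.norm_compContinuousLinearMap_le _ _).trans ?_
    rw [Finset.prod_const, Finset.card_univ, Fintype.card_fin, norm_iteratedFDeriv_iteratedFDeriv]
    gcongr
    exact hC ⟨h, hh⟩ _
  refine ⟨(1 + |M|) ^ k * (‖P‖ * (C * ‖ContinuousLinearMap.inr ℝ E E'‖ ^ k)),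
    fun h hh z ζ ↦ ?_⟩
  by_cases hζ : ‖ζ‖ ≤ M
  · gcongr
    · exact hζ.trans (le_abs_self M)
    · exact hbd h hh z ζ
  -- Beyond radius M the symbol vanishes on a neighbourhood of ζ, hence so do all its derivatives
  -- there; the weight only matters where it is at most (1 + |M|)^k.
  · have hev : (fun ζ' ↦ iteratedFDeriv ℝ j (fun z' ↦ a h z' ζ') z) =ᶠ[𝓝 ζ] fun _ ↦ 0 := by
      filter_upwards [(isOpen_lt continuous_const continuous_norm).mem_nhds (not_le.1 hζ)]
        with ζ' hζ'
      have : (fun z' ↦ a h z' ζ') = 0 := funext fun z' ↦ hM h hh z' ζ' hζ'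
      rw [this]
      simp
    rw [(Filter.EventuallyEq.iteratedFDeriv ℝ hev k).self_of_nhds]
    simp only [iteratedFDeriv_fun_zero, Pi.zero_apply, norm_zero, mul_zero]
    positivity

end UnifBddDerivs

end UniformBounds

/-! ### Left quantization and exact composition rules. -/

section Quantization

/-- `T = a(z, hD)` in the sense that `T` maps Schwartz functions to Schwartz functions, which are
given pointwise by the (absolutely convergent) oscillatory integral. -/
def HasPointwiseSymbol (h : ℝ) (a : Plane → Plane → ℂ) (T : PlaneOp) : Prop :=
  ∀ f : 𝓢(Plane, ℂ), ∃ u : 𝓢(Plane, ℂ), T (f : 𝓢'(Plane, ℂ)) = (u : 𝓢'(Plane, ℂ)) ∧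
    ∀ z : Plane,
      Integrable (fun w : Plane ↦ Complex.exp (2 * Real.pi * Complex.I * (inner ℝ w z : ℝ)) *
          a z ((2 * Real.pi * h) • w) * (𝓕 f : 𝓢(Plane, ℂ)) w) ∧
      u z = ∫ w : Plane, Complex.exp (2 * Real.pi * Complex.I * (inner ℝ w z : ℝ)) *
          a z ((2 * Real.pi * h) • w) * (𝓕 f : 𝓢(Plane, ℂ)) w

theorem SchwartzMap.eq_integral_exp_mul_fourier (f : 𝓢(Plane, ℂ)) (z : Plane) :
    f z = ∫ w : Plane, Complex.exp (2 * Real.pi * Complex.I * (inner ℝ w z : ℝ)) *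
      (𝓕 f : 𝓢(Plane, ℂ)) w := by
  conv_lhs => rw [← FourierTransform.fourierInv_fourier_eq (F := 𝓢(Plane, ℂ)) f]
  rw [SchwartzMap.fourierInv_coe, Real.fourierInv_eq']
  congr 1 with w
  simp only [smul_eq_mul]
  congr 2
  push_cast
  ring

theorem norm_exp_two_pi_I_mul_inner (w z : Plane) :
    ‖Complex.exp (2 * Real.pi * Complex.I * (inner ℝ w z : ℝ))‖ = 1 := by
  rw [mul_right_comm, mul_comm _ Complex.I]
  simp [Complex.norm_exp]

theorem smulLeftCLM_coe_schwartz {g : Plane → ℂ} (hg : g.HasTemperateGrowth)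
    (f : 𝓢(Plane, ℂ)) :
    TemperedDistribution.smulLeftCLM ℂ g (f : 𝓢'(Plane, ℂ)) =
      (SchwartzMap.smulLeftCLM ℂ g f : 𝓢(Plane, ℂ)) := by
  ext φ
  simp [SchwartzMap.smulLeftCLM_apply_apply hg, mul_comm, mul_left_comm]

namespace HasPointwiseSymbol

variable {h : ℝ} {a b : Plane → Plane → ℂ} {S T : PlaneOp}

theorem isQuantization (hT : HasPointwiseSymbol h a T) : IsQuantization h a T := by
  intro f φ
  obtain ⟨u, hu, hz⟩ := hT f
  rw [hu]
  refine (SchwartzMap.toTemperedDistributionCLM_apply_apply volume u φ).trans ?_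
  simp_rw [fun z ↦ (hz z).2, smul_eq_mul]

theorem add (hS : HasPointwiseSymbol h a S) (hT : HasPointwiseSymbol h b T) :
    HasPointwiseSymbol h (fun z ζ ↦ a z ζ + b z ζ) (S + T) := by
  intro f
  obtain ⟨u, hu, hz⟩ := hS f
  obtain ⟨u', hu', hz'⟩ := hT f
  refine ⟨u + u', by simp [hu, hu'], fun z ↦ ?_⟩
  have key := (hz z).1.add (hz' z).1
  simp_rw [mul_add, add_mul]
  refine ⟨key, ?_⟩
  rw [integral_add (hz z).1 (hz' z).1, ← (hz z).2, ← (hz' z).2]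
  rfl

/-- In left quantization a function of z on the left, like a Fourier multiplier on the right
(`comp_cutoffOp`), multiplies the symbol exactly, without remainder. -/
theorem mulOp_comp (hT : HasPointwiseSymbol h a T) {g : Plane → ℂ} (hg : g.HasTemperateGrowth) :
    HasPointwiseSymbol h (fun z ζ ↦ g z * a z ζ) (mulOp g ∘L T) := by
  intro f
  obtain ⟨u, hu, hz⟩ := hT f
  refine ⟨SchwartzMap.smulLeftCLM ℂ g u, ?_, fun z ↦ ?_⟩
  · rw [ContinuousLinearMap.comp_apply, hu, mulOp, smulLeftCLM_coe_schwartz hg]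
  · have e : ∀ w : Plane, Complex.exp (2 * Real.pi * Complex.I * (inner ℝ w z : ℝ)) *
          (g z * a z ((2 * Real.pi * h) • w)) * (𝓕 f : 𝓢(Plane, ℂ)) w =
        g z * (Complex.exp (2 * Real.pi * Complex.I * (inner ℝ w z : ℝ)) *
          a z ((2 * Real.pi * h) • w) * (𝓕 f : 𝓢(Plane, ℂ)) w) := fun w ↦ by ring
    simp_rw [e]
    refine ⟨(hz z).1.const_mul _, ?_⟩
    rw [integral_const_mul, ← (hz z).2, SchwartzMap.smulLeftCLM_apply_apply hg, smul_eq_mul]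

theorem smul (hT : HasPointwiseSymbol h a T) (c : ℂ) :
    HasPointwiseSymbol h (fun z ζ ↦ c * a z ζ) (c • T) := by
  have := hT.mulOp_comp (g := fun _ ↦ c) (Function.HasTemperateGrowth.const c)
  have e : mulOp (fun _ ↦ c) ∘L T = c • T := by
    ext u
    simp [mulOp]
  rwa [e] at this

theorem one : HasPointwiseSymbol h (fun _ _ ↦ 1) 1 := by
  intro f
  refine ⟨f, rfl, fun z ↦ ⟨?_, ?_⟩⟩
  · simp_rw [mul_one]
    exact (𝓕 f : 𝓢(Plane, ℂ)).integrable.bdd_mul (c := 1) (by fun_prop)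
      (Filter.Eventually.of_forall fun w ↦ (norm_exp_two_pi_I_mul_inner w z).le)
  · simp_rw [mul_one]
    exact f.eq_integral_exp_mul_fourier z

theorem comp_cutoffOp (hT : HasPointwiseSymbol h a T) {χ : Plane → ℂ}
    (hχ : (fun w : Plane ↦ χ ((2 * Real.pi * h) • w)).HasTemperateGrowth) :
    HasPointwiseSymbol h (fun z ζ ↦ a z ζ * χ ζ) (T ∘L cutoffOp χ h) := by
  intro f
  obtain ⟨u, hu, hz⟩ := hT (SchwartzMap.fourierMultiplierCLM ℂ
    (fun w : Plane ↦ χ ((2 * Real.pi * h) • w)) f)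
  refine ⟨u, ?_, fun z ↦ ?_⟩
  · rw [← hu, ContinuousLinearMap.comp_apply, cutoffOp,
      TemperedDistribution.fourierMultiplierCLM_toTemperedDistributionCLM_eq hχ]
  · have e : ∀ w : Plane, (𝓕 (SchwartzMap.fourierMultiplierCLM ℂ
        (fun w : Plane ↦ χ ((2 * Real.pi * h) • w)) f) : 𝓢(Plane, ℂ)) w =
        χ ((2 * Real.pi * h) • w) * (𝓕 f : 𝓢(Plane, ℂ)) w := by
      intro w
      rw [SchwartzMap.fourierMultiplierCLM_apply, FourierTransform.fourier_fourierInv_eq,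
        SchwartzMap.smulLeftCLM_apply_apply hχ, smul_eq_mul]
    have := hz z
    simp_rw [e, ← mul_assoc] at this
    simp_rw [← mul_assoc]
    exact this

end HasPointwiseSymbol

end Quantization

/-! ### The exact symbol of ψ(hD_y)v. -/

section Composition

/-- The symbol of the composition of a Fourier multiplier in `y`, whose kernel is `K`, with
multiplication by `v`. -/
noncomputable def compSymbol (K : 𝓢(ℝ, ℂ)) (v : Plane → ℂ) (h : ℝ) (z ζ : Plane) : ℂ :=
  ∫ t : ℝ, K t * (v (z - (h * t) • EuclideanSpace.single 1 (1 : ℝ)) *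
    Complex.exp ((-(t * ζ 1) : ℝ) * Complex.I))

/-- ψ(hD_y) is the superposition, with weight K(t), of the translations by ht in y. Each translation
passes through v by shifting it, and acts on plane waves as e^{-itη}. -/
theorem hasPointwiseSymbol_cutoffOp_comp_mulOp {h : ℝ} {ψ : ℝ → ℂ} {K : 𝓢(ℝ, ℂ)}
    (hK : ∀ s : ℝ, ψ (2 * Real.pi * s) =
      ∫ t, K t * Complex.exp ((-(t * (2 * Real.pi * s)) : ℝ) * Complex.I))
    (hψ : (fun w : Plane ↦ ψ (((2 * Real.pi * h) • w) 1)).HasTemperateGrowth)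
    {v : Plane → ℂ} (hv : v.HasTemperateGrowth) {C : ℝ} (hC : ∀ z, ‖v z‖ ≤ C) :
    HasPointwiseSymbol h (compSymbol K v h) (cutoffOp (fun ζ ↦ ψ (ζ 1)) h ∘L mulOp v) := by
  intro f
  set e : Plane := EuclideanSpace.single 1 (1 : ℝ) with he
  set g : 𝓢(Plane, ℂ) := SchwartzMap.smulLeftCLM ℂ v f with hg
  refine ⟨SchwartzMap.fourierMultiplierCLM ℂ (fun w : Plane ↦ ψ (((2 * Real.pi * h) • w) 1)) g,
    ?_, fun z ↦ ?_⟩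
  · rw [ContinuousLinearMap.comp_apply, mulOp, smulLeftCLM_coe_schwartz hv, cutoffOp,
      TemperedDistribution.fourierMultiplierCLM_toTemperedDistributionCLM_eq hψ]
  have hvc : Continuous v := hv.1.continuous
  have hexp : ∀ (t : ℝ) (w : Plane),
      Complex.exp (2 * Real.pi * Complex.I * (inner ℝ w (z - (h * t) • e) : ℝ)) =
      Complex.exp (2 * Real.pi * Complex.I * (inner ℝ w z : ℝ)) *
        Complex.exp ((-(t * ((2 * Real.pi * h) • w) 1) : ℝ) * Complex.I) := by
    intro t w
    rw [← Complex.exp_add, inner_sub_right, inner_smul_right, he,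
      EuclideanSpace.inner_single_right]
    congr 1
    simp
    ring
  have hbase : ∀ φ : 𝓢(Plane, ℂ),
      Integrable (fun p : Plane × ℝ ↦ (𝓕 φ : 𝓢(Plane, ℂ)) p.1 * K p.2) := fun φ ↦
    (𝓕 φ : 𝓢(Plane, ℂ)).integrable.mul_prod K.integrable
  have hint1 : Integrable (fun p : Plane × ℝ ↦
      Complex.exp (2 * Real.pi * Complex.I * (inner ℝ p.1 (z - (h * p.2) • e) : ℝ)) *
        ((𝓕 g : 𝓢(Plane, ℂ)) p.1 * K p.2)) :=
    (hbase g).bdd_mul (c := 1) (by fun_prop)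
      (Filter.Eventually.of_forall fun p ↦ (norm_exp_two_pi_I_mul_inner _ _).le)
  have hint2 : Integrable (fun p : Plane × ℝ ↦
      (v (z - (h * p.2) • e) * Complex.exp (2 * Real.pi * Complex.I *
        (inner ℝ p.1 (z - (h * p.2) • e) : ℝ))) * ((𝓕 f : 𝓢(Plane, ℂ)) p.1 * K p.2)) :=
    (hbase f).bdd_mul (c := C) (by fun_prop)
      (Filter.Eventually.of_forall fun p ↦ by
        rw [norm_mul, norm_exp_two_pi_I_mul_inner, mul_one]; exact hC _)
  have hsymb : ∀ w : Plane,
      Complex.exp (2 * Real.pi * Complex.I * (inner ℝ w z : ℝ)) *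
          compSymbol K v h z ((2 * Real.pi * h) • w) * (𝓕 f : 𝓢(Plane, ℂ)) w =
        ∫ t : ℝ, (v (z - (h * t) • e) * Complex.exp (2 * Real.pi * Complex.I *
        (inner ℝ w (z - (h * t) • e) : ℝ))) * ((𝓕 f : 𝓢(Plane, ℂ)) w * K t) := by
    intro w
    rw [compSymbol, ← integral_const_mul, ← integral_mul_const]
    congr 1 with t
    rw [hexp]
    ring
  simp_rw [hsymb]
  refine ⟨hint2.integral_prod_left, ?_⟩
  rw [integral_integral_swap hint2, SchwartzMap.eq_integral_exp_mul_fourier]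
  have hmult : ∀ w : Plane, Complex.exp (2 * Real.pi * Complex.I * (inner ℝ w z : ℝ)) *
      (𝓕 (SchwartzMap.fourierMultiplierCLM ℂ (fun w : Plane ↦ ψ (((2 * Real.pi * h) • w) 1)) g)
        : 𝓢(Plane, ℂ)) w = ∫ t : ℝ,
      Complex.exp (2 * Real.pi * Complex.I * (inner ℝ w (z - (h * t) • e) : ℝ)) *
        ((𝓕 g : 𝓢(Plane, ℂ)) w * K t) := by
    intro w
    rw [SchwartzMap.fourierMultiplierCLM_apply, FourierTransform.fourier_fourierInv_eq,
        SchwartzMap.smulLeftCLM_apply_apply hψ, smul_eq_mul]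
    rw [show ((2 * Real.pi * h) • w) 1 = 2 * Real.pi * (h * w 1) from
      mul_assoc (2 * Real.pi) h (w 1), hK,
      mul_left_comm, ← integral_mul_const]
    congr 1 with t
    rw [hexp, show ((2 * Real.pi * h) • w) 1 = 2 * Real.pi * (h * w 1) from
      mul_assoc (2 * Real.pi) h (w 1)]
    ring
  simp_rw [hmult]
  rw [integral_integral_swap hint1]
  -- For fixed t, Fourier inversion for f and for g = vf reduces both sides to K(t) (vf)(z - hte).
  congr 1 with t
  have h1 := SchwartzMap.eq_integral_exp_mul_fourier g (z - (h * t) • e)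
  have h2 := SchwartzMap.eq_integral_exp_mul_fourier f (z - (h * t) • e)
  have h3 : ∀ w : Plane, (v (z - (h * t) • e) * Complex.exp (2 * Real.pi * Complex.I *
        (inner ℝ w (z - (h * t) • e) : ℝ))) * ((𝓕 f : 𝓢(Plane, ℂ)) w * K t) =
      (v (z - (h * t) • e) * K t) * (Complex.exp (2 * Real.pi * Complex.I *
        (inner ℝ w (z - (h * t) • e) : ℝ)) * (𝓕 f : 𝓢(Plane, ℂ)) w) := fun w ↦ by ring
  simp_rw [h3, ← mul_assoc (Complex.exp _), integral_mul_const, integral_const_mul]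
  rw [← h1, ← h2, hg, SchwartzMap.smulLeftCLM_apply_apply hv, smul_eq_mul]
  ring

theorem iteratedDeriv_exp_mul_I (k : ℕ) :
    iteratedDeriv k (fun s : ℝ ↦ Complex.exp ((s : ℂ) * Complex.I)) =
      fun s : ℝ ↦ Complex.I ^ k * Complex.exp ((s : ℂ) * Complex.I) := by
  induction k with
  | zero => simp
  | succ k ih =>
    rw [iteratedDeriv_succ, ih]
    ext s
    have h : HasDerivAt (fun s : ℝ ↦ Complex.exp ((s : ℂ) * Complex.I))
        (Complex.exp ((s : ℂ) * Complex.I) * (1 * Complex.I)) s :=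
      ((hasDerivAt_id (s : ℂ)).mul_const Complex.I).cexp.comp_ofReal
    rw [(h.const_mul (Complex.I ^ k)).deriv]
    ring

theorem contDiff_exp_mul_I : ContDiff ℝ ∞ fun s : ℝ ↦ Complex.exp ((s : ℂ) * Complex.I) :=
  (Complex.ofRealCLM.contDiff.mul contDiff_const).cexp

theorem norm_iteratedFDeriv_exp_mul_I (k : ℕ) (s : ℝ) :
    ‖iteratedFDeriv ℝ k (fun s : ℝ ↦ Complex.exp ((s : ℂ) * Complex.I)) s‖ = 1 := by
  rw [norm_iteratedFDeriv_eq_norm_iteratedDeriv, iteratedDeriv_exp_mul_I]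
  simp [Complex.norm_exp_ofReal_mul_I]

/-- Each derivative in η costs a factor t, absorbed by the rapid decay of K; the shift by ht leaves
the bounds on v unchanged, so h does not enter. -/
theorem unifBddDerivs_compSymbol (K : 𝓢(ℝ, ℂ)) {v : Plane → ℂ}
    (hv : UnifBddDerivs fun _ : Unit ↦ v) :
    UnifBddDerivs fun (h : Set.Ioc (0 : ℝ) 1) (p : Plane × Plane) ↦ compSymbol K v h p.1 p.2 := by
  set e : Plane := EuclideanSpace.single 1 (1 : ℝ) with he
  have hA : UnifBddDerivs fun (i : ℝ) (p : Plane × Plane) ↦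
      v (-(i • e) + ContinuousLinearMap.fst ℝ Plane Plane p) :=
    hv.comp_affine (fun _ ↦ ()) (fun i : ℝ ↦ -(i • e))
      (fun _ ↦ ContinuousLinearMap.fst ℝ Plane Plane) fun _ ↦ le_rfl
  choose C hC0 hC using hA.exists_nonneg_bound
  let π : Plane × Plane →L[ℝ] ℝ :=
    (EuclideanSpace.proj (1 : Fin 2)) ∘L ContinuousLinearMap.snd ℝ Plane Plane
  have hB : ∀ (t : ℝ) (j : ℕ) (p : Plane × Plane),
      ‖iteratedFDeriv ℝ j (fun p : Plane × Plane ↦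
        Complex.exp ((((-t) • π) p : ℝ) * Complex.I)) p‖ ≤ |t| ^ j * ‖π‖ ^ j := by
    intro t j p
    have h1 := ContinuousLinearMap.iteratedFDeriv_comp_right ((-t) • π) contDiff_exp_mul_I p
      (i := j) (by exact_mod_cast le_top)
    refine (congrArg norm h1).le.trans
      ((ContinuousMultilinearMap.norm_compContinuousLinearMap_le _ _).trans ?_)
    rw [norm_iteratedFDeriv_exp_mul_I, Finset.prod_const, Finset.card_univ, Fintype.card_fin,
      one_mul, norm_smul, mul_pow, norm_neg, Real.norm_eq_abs]
  refine UnifBddDerivs.integral (μ := volume) (Φ := fun (h : Set.Ioc (0 : ℝ) 1) (t : ℝ)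
    (p : Plane × Plane) ↦ K t * (v (p.1 - ((h : ℝ) * t) • e) *
      Complex.exp ((-(t * p.2 1) : ℝ) * Complex.I)))
    (β := fun k t ↦ ∑ j ∈ Finset.range (k + 1), (k.choose j : ℝ) * C j * ‖π‖ ^ (k - j) *
      (‖t‖ ^ (k - j) * ‖K t‖)) (fun h ↦ ?_) (fun k ↦ ?_) (fun h k ↦ ?_)
  · refine ((K.smooth ⊤).comp contDiff_fst).mul (((hv.1 ()).comp ?_).mul
      (contDiff_exp_mul_I.comp ?_))
    · fun_prop
    · fun_prop
  · exact integrable_finsetSum _ fun j _ ↦ (K.integrable_pow_mul volume (k - j)).const_mul _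
  · refine Filter.Eventually.of_forall fun t p ↦ ?_
    have h1 : (fun p : Plane × Plane ↦ K t * (v (p.1 - ((h : ℝ) * t) • e) *
        Complex.exp ((-(t * p.2 1) : ℝ) * Complex.I))) = K t • fun p : Plane × Plane ↦
        (v (-(((h : ℝ) * t) • e) + ContinuousLinearMap.fst ℝ Plane Plane p)) *
        Complex.exp ((((-t) • π) p : ℝ) * Complex.I) := by
      ext p
      simp [π, neg_add_eq_sub]
    have hBs : ContDiff ℝ ∞ fun p : Plane × Plane ↦
        Complex.exp ((((-t) • π) p : ℝ) * Complex.I) :=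
      contDiff_exp_mul_I.comp ((-t) • π).contDiff
    rw [h1, iteratedFDeriv_const_smul_apply
      (((hA.1 _).mul hBs).of_le (by exact_mod_cast le_top)).contDiffAt, norm_smul]
    refine (mul_le_mul_of_nonneg_left (norm_iteratedFDeriv_mul_le (hA.1 _) hBs p (n := k)
      (by exact_mod_cast le_top)) (norm_nonneg _)).trans ?_
    rw [Finset.mul_sum]
    refine Finset.sum_le_sum fun j _ ↦ ?_
    calc _ ≤ ‖K t‖ * ((k.choose j : ℝ) * C j * (|t| ^ (k - j) * ‖π‖ ^ (k - j))) := by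
          gcongr
          · exact mul_nonneg (by positivity) (hC0 j)
          · exact hC j _ p
          · exact hB t _ p
      _ = _ := by rw [Real.norm_eq_abs]; ring

/-- K is the inverse Fourier transform of s ↦ ψ(2πs); the 2π matches the normalization of `𝓕`. -/
theorem exists_schwartz_kernel {ψ : ℝ → ℂ} (hψ : ContDiff ℝ ∞ ψ) (hc : HasCompactSupport ψ) :
    ∃ K : 𝓢(ℝ, ℂ), ∀ s : ℝ, ψ (2 * Real.pi * s) =
      ∫ t, K t * Complex.exp ((-(t * (2 * Real.pi * s)) : ℝ) * Complex.I) := by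
  have h2 : (2 * Real.pi) ≠ 0 := by positivity
  have hc' : HasCompactSupport fun s : ℝ ↦ ψ (2 * Real.pi * s) :=
    hc.comp_homeomorph (Homeomorph.mulLeft₀ (2 * Real.pi) h2)
  have hs' : ContDiff ℝ ∞ fun s : ℝ ↦ ψ (2 * Real.pi * s) := hψ.comp (by fun_prop)
  refine ⟨𝓕⁻ (hc'.toSchwartzMap hs'), fun s ↦ ?_⟩
  have h := FourierTransform.fourier_fourierInv_eq (F := 𝓢(ℝ, ℂ)) (hc'.toSchwartzMap hs')
  have h' := congrArg (fun f : 𝓢(ℝ, ℂ) ↦ f s) h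
  simp only [SchwartzMap.fourier_coe, Real.fourier_real_eq_integral_exp_smul] at h'
  refine h'.symm.trans ?_
  congr 1 with t
  rw [smul_eq_mul, mul_comm]
  congr 3
  push_cast
  ring

end Composition

/-! ### Translations and preservation of periodicity. -/

section Translation

/-- Translation of tempered distributions, dual to translation of Schwartz functions. -/
noncomputable def translationOp (v : Plane) : PlaneOp :=
  PointwiseConvergenceCLM.precomp ℂ (SchwartzMap.compSubConstCLM ℂ v)

theorem translationOp_apply_apply (v : Plane) (u : 𝓢'(Plane, ℂ)) (φ : 𝓢(Plane, ℂ)) :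
    translationOp v u φ = u (φ.compSubConstCLM ℂ v) := rfl

theorem commute_translationOp_mulOp {g : Plane → ℂ} (hg : g.HasTemperateGrowth) {v : Plane}
    (hv : ∀ z, g (z + v) = g z) : Commute (translationOp v) (mulOp g) := by
  ext u φ
  change u (SchwartzMap.smulLeftCLM ℂ g (φ.compSubConstCLM ℂ v)) =
    u ((SchwartzMap.smulLeftCLM ℂ g φ).compSubConstCLM ℂ v)
  congr 1
  ext z
  simp only [SchwartzMap.smulLeftCLM_apply_apply hg, SchwartzMap.compSubConstCLM_apply]
  rw [← hv (z - v), sub_add_cancel]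

theorem hasTemperateGrowth_planeWave (v : Plane) :
    (fun w : Plane ↦ Complex.exp ((2 * Real.pi * inner ℝ w v : ℝ) *
      Complex.I)).HasTemperateGrowth := by
  have h : UnifBddDerivs fun (_ : Unit) (s : ℝ) ↦ Complex.exp ((s : ℂ) * Complex.I) :=
    ⟨fun _ ↦ contDiff_exp_mul_I, fun k ↦ ⟨1, fun _ s ↦ (norm_iteratedFDeriv_exp_mul_I k s).le⟩⟩
  have h' := (h.comp_affine id (fun _ ↦ 0) (fun _ ↦ (2 * Real.pi) • innerSL ℝ v)
    fun _ ↦ le_rfl).hasTemperateGrowth ()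
  convert h' using 4 with w
  simp [real_inner_comm]

theorem fourierInv_compSubConstCLM (φ : 𝓢(Plane, ℂ)) (v : Plane) :
    𝓕⁻ (φ.compSubConstCLM ℂ v) = SchwartzMap.smulLeftCLM ℂ
      (fun w : Plane ↦ Complex.exp ((2 * Real.pi * inner ℝ w v : ℝ) * Complex.I)) (𝓕⁻ φ) := by
  ext w
  rw [SchwartzMap.smulLeftCLM_apply_apply (hasTemperateGrowth_planeWave v),
    SchwartzMap.fourierInv_coe, SchwartzMap.fourierInv_coe, Real.fourierInv_eq',
    Real.fourierInv_eq', ← integral_add_right_eq_self _ v, ← integral_smul]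
  congr 1 with x
  simp only [SchwartzMap.compSubConstCLM_apply, add_sub_cancel_right, smul_eq_mul, ← mul_assoc,
    ← Complex.exp_add]
  congr 2
  rw [inner_add_left, real_inner_comm v w]
  push_cast
  ring

/-- On the Fourier side a translation is multiplication by a plane wave, and multiplications
commute. -/
theorem commute_translationOp_cutoffOp {χ : Plane → ℂ} {h : ℝ}
    (hχ : (fun w : Plane ↦ χ ((2 * Real.pi * h) • w)).HasTemperateGrowth) (v : Plane) :
    Commute (translationOp v) (cutoffOp χ h) := by
  have he := hasTemperateGrowth_planeWave v
  set m : Plane → ℂ := fun w ↦ χ ((2 * Real.pi * h) • w) with hm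
  ext u φ
  change u (𝓕 (SchwartzMap.smulLeftCLM ℂ m (𝓕⁻ (φ.compSubConstCLM ℂ v)))) =
    u ((𝓕 (SchwartzMap.smulLeftCLM ℂ m (𝓕⁻ φ))).compSubConstCLM ℂ v)
  congr 1
  have hinj : Function.Injective (𝓕⁻ : 𝓢(Plane, ℂ) → 𝓢(Plane, ℂ)) :=
    (FourierTransform.fourierEquiv ℂ 𝓢(Plane, ℂ)).symm.injective
  apply hinj
  rw [fourierInv_compSubConstCLM, fourierInv_compSubConstCLM,
    FourierTransform.fourierInv_fourier_eq, FourierTransform.fourierInv_fourier_eq,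
    SchwartzMap.smulLeftCLM_smulLeftCLM_apply hχ he,
    SchwartzMap.smulLeftCLM_smulLeftCLM_apply he hχ, mul_comm]

/-- F^* turns periodicity under the lattice into invariance under its image by F⁻¹, and an operator
commuting with those translations keeps invariant distributions invariant. -/
theorem preservesPeriodicity_conjOp {A B : ℝ} {F : Plane ≃ₗᵢ[ℝ] Plane} {T : PlaneOp}
    (hT : ∀ j k : ℤ, Commute (translationOp (F.symm (latticeVec A B j k))) T) :
    PreservesPeriodicity A B (conjOp F T) := by
  intro u hu j k φ
  set ℓ := latticeVec A B j k
  have hinv : translationOp (F.symm ℓ) (pullbackOp F u) = pullbackOp F u := by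
    ext ψ
    rw [translationOp_apply_apply]
    change u _ = u _
    conv_rhs => rw [← hu j k]
    congr 1
    ext z
    simp [SchwartzMap.compSubConstCLM_apply, ℓ]
  have h1 : translationOp (F.symm ℓ) (T (pullbackOp F u)) = T (pullbackOp F u) := by
    have := congrArg (fun S : PlaneOp ↦ S (pullbackOp F u)) (hT j k).eq
    simp only [mul_apply_eq_comp] at this
    rw [this, hinv]
  change T (pullbackOp F u) _ = T (pullbackOp F u) _
  conv_rhs => rw [← h1, translationOp_apply_apply]
  congr 1
  ext z
  simp [SchwartzMap.compSubConstCLM_apply]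

end Translation

/-! ### Commutators of D, multiplications and Fourier multipliers. -/

section OperatorCalculus

/-- `D_x g` for `i = 0` and `D_y g` for `i = 1`. -/
noncomputable def funD (i : Fin 2) (g : Plane → ℂ) (z : Plane) : ℂ :=
  -Complex.I * fderiv ℝ g z (EuclideanSpace.single i (1 : ℝ))

theorem UnifBddDerivs.funD {g : Plane → ℂ} (hg : UnifBddDerivs fun _ : Unit ↦ g) (i : Fin 2) :
    UnifBddDerivs fun _ : Unit ↦ funD i g :=
  (hg.lineDeriv _).const_mul _

theorem diffD_mul_mulOp {g : Plane → ℂ} (hg : UnifBddDerivs fun _ : Unit ↦ g) (i : Fin 2) :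
    diffD i * mulOp g = mulOp (funD i g) + mulOp g * diffD i := by
  set e : Plane := EuclideanSpace.single i (1 : ℝ) with he
  have hg0 : g.HasTemperateGrowth := hg.hasTemperateGrowth ()
  have hg1 : (_root_.funD i g).HasTemperateGrowth := (hg.funD i).hasTemperateGrowth ()
  ext u φ
  change -Complex.I • u (SchwartzMap.smulLeftCLM ℂ g (-LineDeriv.lineDerivOp e φ)) =
    u (SchwartzMap.smulLeftCLM ℂ (_root_.funD i g) φ) +
      -Complex.I • u (-LineDeriv.lineDerivOp e (SchwartzMap.smulLeftCLM ℂ g φ))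
  rw [← map_smul u, ← map_smul u, ← map_add u]
  congr 1
  ext z
  have hd : HasFDerivAt (SchwartzMap.smulLeftCLM ℂ g φ)
      (g z • fderiv ℝ φ z + φ z • fderiv ℝ g z) z := by
    have h1 : (SchwartzMap.smulLeftCLM ℂ g φ : Plane → ℂ) = fun z ↦ g z * φ z := by
      ext z; rw [SchwartzMap.smulLeftCLM_apply_apply hg0, smul_eq_mul]
    rw [h1]
    exact (((hg.contDiff ()).differentiable (by simp)) z).hasFDerivAt.mul (φ.hasFDerivAt z)
  have hd' := hd.fderiv
  simp only [smul_apply, add_apply, neg_apply,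
    SchwartzMap.smulLeftCLM_apply_apply hg0, SchwartzMap.smulLeftCLM_apply_apply hg1,
    SchwartzMap.lineDerivOp_apply_eq_fderiv, hd', _root_.funD, smul_eq_mul]
  ring

/-- Leibniz twice, arranged so that the surviving first-order D stands rightmost, where it will meet
ψ(hD_y). -/
theorem mulOp_mul_diffD_mul_diffD {g : Plane → ℂ} (hg : UnifBddDerivs fun _ : Unit ↦ g)
    (i : Fin 2) :
    mulOp g * (diffD i * diffD i) = diffD i * diffD i * mulOp g -
      (2 : ℂ) • (mulOp (funD i g) * diffD i) - mulOp (funD i (funD i g)) := by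
  rw [mul_assoc (diffD i), diffD_mul_mulOp hg, mul_add, diffD_mul_mulOp (hg.funD i),
    ← mul_assoc (diffD i) (mulOp g),
    diffD_mul_mulOp hg, two_smul]
  noncomm_ring

theorem Function.HasTemperateGrowth.comp_const_smul {χ : Plane → ℂ}
    (hχ : χ.HasTemperateGrowth) (c : ℝ) : (fun w : Plane ↦ χ (c • w)).HasTemperateGrowth :=
  hχ.comp (c • ContinuousLinearMap.id ℝ Plane).hasTemperateGrowth

theorem cutoffOp_mul_cutoffOp {χ₁ χ₂ : Plane → ℂ} (h₁ : χ₁.HasTemperateGrowth)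
    (h₂ : χ₂.HasTemperateGrowth) (h : ℝ) :
    cutoffOp χ₁ h * cutoffOp χ₂ h = cutoffOp (fun ζ ↦ χ₁ ζ * χ₂ ζ) h := by
  refine (TemperedDistribution.fourierMultiplierCLM_compL_fourierMultiplierCLM
    (h₂.comp_const_smul _) (h₁.comp_const_smul _)).trans ?_
  rw [mul_comm]
  rfl

theorem hasTemperateGrowth_coord (i : Fin 2) :
    (fun ζ : Plane ↦ ((ζ i : ℝ) : ℂ)).HasTemperateGrowth :=
  (Complex.ofRealCLM ∘L EuclideanSpace.proj i).hasTemperateGrowth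

theorem smul_diffD_eq_cutoffOp (i : Fin 2) (h : ℝ) :
    (h : ℂ) • diffD i = cutoffOp (fun ζ ↦ (ζ i : ℂ)) h := by
  have h1 : (fun w : Plane ↦ ((((2 * Real.pi * h) • w) i : ℝ) : ℂ)) =
      ((2 * Real.pi * h : ℝ) : ℂ) • fun w : Plane ↦
        ((inner ℝ w (EuclideanSpace.single i (1 : ℝ)) : ℝ) : ℂ) := by
    ext w
    rw [Pi.smul_apply, EuclideanSpace.inner_single_right]
    simp
  rw [cutoffOp, h1, TemperedDistribution.fourierMultiplierCLM_smul (by fun_prop)]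
  ext1 u
  simp only [diffD, smul_apply, LineDeriv.lineDerivOpCLM_apply,
    TemperedDistribution.lineDeriv_eq_fourierMultiplierCLM, smul_smul]
  congr 1
  push_cast
  linear_combination (-2 * (h : ℂ) * Real.pi) * Complex.I_mul_I

theorem commute_diffD_cutoffOp {χ : Plane → ℂ} (hχ : χ.HasTemperateGrowth) (i : Fin 2) {h : ℝ}
    (hh : h ≠ 0) : Commute (diffD i) (cutoffOp χ h) := by
  have h1 : Commute ((h : ℂ) • diffD i) (cutoffOp χ h) := by
    rw [smul_diffD_eq_cutoffOp, Commute, SemiconjBy,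
      cutoffOp_mul_cutoffOp (hasTemperateGrowth_coord i) hχ,
      cutoffOp_mul_cutoffOp hχ (hasTemperateGrowth_coord i)]
    simp_rw [mul_comm]
  have h2 := h1.smul_left ((h : ℂ)⁻¹)
  rwa [smul_smul, inv_mul_cancel₀ (by exact_mod_cast hh), one_smul] at h2

end OperatorCalculus

/-! ### Cutoffs in frequency. -/

section Cutoffs

/-- The support of χ is compact and disjoint from {η = 0}, so |η| has a positive minimum on it. -/
theorem exists_bounds_of_vanishing_near_line {χ : Plane → ℂ} (hχc : HasCompactSupport χ)
    (hχ0 : ∀ᶠ ζ in 𝓝ˢ {ζ : Plane | ζ 1 = 0}, χ ζ = 0) :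
    ∃ c M : ℝ, 0 < c ∧ c < M ∧ ∀ ζ, χ ζ ≠ 0 → c ≤ |ζ 1| ∧ ‖ζ‖ ≤ M := by
  have hne : ∀ ζ ∈ tsupport χ, (0 : ℝ) < |ζ 1| := by
    intro ζ hζ
    refine abs_pos.2 fun h0 ↦ ?_
    exact notMem_tsupport_iff_eventuallyEq.2 (eventually_nhdsSet_iff_forall.1 hχ0 ζ h0) hζ
  obtain ⟨c, hc, hcle⟩ := hχc.isCompact.exists_forall_le' (f := fun ζ : Plane ↦ |ζ 1|)
    (by fun_prop) hne
  obtain ⟨M, hM⟩ := hχc.isCompact.isBounded.exists_norm_le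
  -- The maximum guarantees c < M, needed for the bump radii, even when χ = 0.
  refine ⟨c, max M (c + 1), hc, by simp, fun ζ hζ ↦ ?_⟩
  have hm := subset_tsupport χ hζ
  exact ⟨hcle ζ hm, (hM ζ hm).trans (le_max_left _ _)⟩

theorem exists_smooth_half_inv {c M : ℝ} (hc : 0 < c) (hM : c < M) :
    ∃ ψ : ℝ → ℂ, ContDiff ℝ ∞ ψ ∧ HasCompactSupport ψ ∧
      ∀ η : ℝ, c ≤ |η| → |η| ≤ M → 2 * η * ψ η = 1 := by
  let f : ContDiffBump (0 : ℝ) := ⟨M, M + 1, hc.trans hM, by linarith⟩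
  let g : ContDiffBump (0 : ℝ) := ⟨c / 2, c, by linarith, by linarith⟩
  have hf : HasCompactSupport fun η : ℝ ↦ ((f η : ℝ) : ℂ) :=
    f.hasCompactSupport.comp_left (g := fun x : ℝ ↦ (x : ℂ)) (by simp)
  -- The factor 1 - g removes the pole of 1/(2η) at 0 and equals 1 for |η| ≥ c; f makes the support
  -- compact and equals 1 for |η| ≤ M.
  refine ⟨fun η ↦ (f η : ℂ) * ((1 - g η : ℝ) * (2 * η : ℂ)⁻¹), ?_, hf.mul_right, ?_⟩
  · refine contDiff_iff_contDiffAt.2 fun η ↦ ?_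
    rcases eq_or_ne η 0 with rfl | hη
    · have h : (fun η ↦ (f η : ℂ) * ((1 - g η : ℝ) * (2 * η : ℂ)⁻¹)) =ᶠ[𝓝 (0 : ℝ)] fun _ ↦ 0 := by
        filter_upwards [g.eventuallyEq_one] with η hη
        simp [hη]
      exact contDiffAt_const.congr_of_eventuallyEq h
    · have h1 : ContDiffAt ℝ ∞ (fun η : ℝ ↦ (f η : ℂ)) η :=
        Complex.ofRealCLM.contDiff.contDiffAt.comp η f.contDiffAt
      have h2 : ContDiffAt ℝ ∞ (fun η : ℝ ↦ ((1 - g η : ℝ) : ℂ)) η :=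
        Complex.ofRealCLM.contDiff.contDiffAt.comp η (contDiffAt_const.sub g.contDiffAt)
      have h3 : ContDiffAt ℝ ∞ (fun η : ℝ ↦ (2 * η : ℂ)) η :=
        contDiffAt_const.mul Complex.ofRealCLM.contDiff.contDiffAt
      exact h1.mul (h2.mul (h3.inv (by simpa using hη)))
  · intro η h1 h2
    have hη : η ≠ 0 := abs_pos.1 (hc.trans_le h1)
    beta_reduce
    rw [f.one_of_mem_closedBall (by simpa [f] using h2),
      g.zero_of_le_dist (by simpa [g] using h1)]
    have : (η : ℂ) ≠ 0 := by exact_mod_cast hη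
    simp
    field_simp

/-- The function ξ is not a symbol of order 0. Truncating it outside the range seen by χ makes it
one and keeps the zero at ξ = 0. -/
theorem exists_smooth_coord {M : ℝ} (hM : 0 < M) :
    ∃ θ : ℝ → ℂ, ContDiff ℝ ∞ θ ∧ HasCompactSupport θ ∧ θ 0 = 0 ∧
      ∀ ξ : ℝ, |ξ| ≤ M → θ ξ = ξ := by
  let f : ContDiffBump (0 : ℝ) := ⟨M, M + 1, hM, by linarith⟩
  have hf : HasCompactSupport fun η : ℝ ↦ ((f η : ℝ) : ℂ) :=
    f.hasCompactSupport.comp_left (g := fun x : ℝ ↦ (x : ℂ)) (by simp)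
  refine ⟨fun ξ ↦ (f ξ : ℂ) * ξ, ?_, hf.mul_right, by simp, fun ξ hξ ↦ ?_⟩
  · exact (Complex.ofRealCLM.contDiff.comp f.contDiff).mul Complex.ofRealCLM.contDiff
  · beta_reduce
    rw [f.one_of_mem_closedBall (by simpa [f] using hξ)]
    simp

end Cutoffs

/-! ### Averages in y and the primitive of v - V₀. -/

section Averages

/-- All derivatives are periodic too, and every point is a lattice translate of one in a fixed ball,
where continuity gives bounds. -/
theorem unifBddDerivs_of_periodic {A B : ℝ} (hA : A ≠ 0) (hB : B ≠ 0) {V : Plane → ℂ}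
    (hV : ContDiff ℝ ∞ V) (hVper : ∀ (j k : ℤ) (z : Plane), V (z + latticeVec A B j k) = V z) :
    UnifBddDerivs fun _ : Unit ↦ V := by
  refine ⟨fun _ ↦ hV, fun k ↦ ?_⟩
  have hcont : Continuous (iteratedFDeriv ℝ k V) :=
    hV.continuous_iteratedFDeriv (by exact_mod_cast le_top)
  obtain ⟨C, hC⟩ := (isCompact_closedBall (0 : Plane) (|A| + |B|)).exists_bound_of_continuousOn
    hcont.continuousOn
  refine ⟨C, fun _ z ↦ ?_⟩
  set ℓ := latticeVec A B (-⌊z 0 / A⌋) (-⌊z 1 / B⌋) with hℓ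
  have h1 : iteratedFDeriv ℝ k V z = iteratedFDeriv ℝ k V (z + ℓ) := by
    rw [← iteratedFDeriv_comp_add_right]
    congr 1
    ext z
    exact (hVper _ _ z).symm
  rw [h1]
  refine hC _ ?_
  have hfr : ∀ x L : ℝ, L ≠ 0 → |x + -⌊x / L⌋ * L| ≤ |L| := by
    intro x L hL
    have : x + -⌊x / L⌋ * L = Int.fract (x / L) * L := by
      rw [Int.fract]; field_simp; ring
    rw [this, abs_mul, Int.abs_fract]
    exact mul_le_of_le_one_left (abs_nonneg L) (Int.fract_lt_one _).le
  rw [mem_closedBall_zero_iff, EuclideanSpace.norm_eq, Fin.sum_univ_two]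
  have h0 : ‖(z + ℓ) 0‖ ≤ |A| := by simpa [hℓ, latticeVec] using hfr (z 0) A hA
  have h1 : ‖(z + ℓ) 1‖ ≤ |B| := by simpa [hℓ, latticeVec] using hfr (z 1) B hB
  refine Real.sqrt_le_iff.2 ⟨by positivity, ?_⟩
  nlinarith [norm_nonneg ((z + ℓ) 0), norm_nonneg ((z + ℓ) 1)]

/-- The weighted average `∫₀ᵇ c(s) v(x, y + s) ds`. -/
noncomputable def shiftAverage (b : ℝ) (c : ℝ → ℂ) (v : Plane → ℂ) (z : Plane) : ℂ :=
  ∫ s in (0 : ℝ)..b, c s * v (z + s • EuclideanSpace.single 1 (1 : ℝ))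

theorem exists_norm_iteratedFDeriv_shiftAverage_integrand_le {b : ℝ} {c : ℝ → ℂ} {M : ℝ}
    (hM : ∀ s ∈ Set.Ioc 0 b, ‖c s‖ ≤ M) {v : Plane → ℂ} (hv : UnifBddDerivs fun _ : Unit ↦ v)
    (k : ℕ) :
    ∃ C : ℝ, ∀ᵐ s ∂volume.restrict (Set.Ioc 0 b), ∀ z, ‖iteratedFDeriv ℝ k
      (fun z ↦ c s * v (z + s • EuclideanSpace.single 1 (1 : ℝ))) z‖ ≤ C := by
  obtain ⟨C, hC0, hC⟩ := hv.exists_nonneg_bound k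
  refine ⟨M * C, ?_⟩
  filter_upwards [ae_restrict_mem measurableSet_Ioc] with s hs z
  have h : ContDiff ℝ ∞ fun z ↦ v (z + s • EuclideanSpace.single 1 (1 : ℝ)) :=
    (hv.contDiff ()).comp (contDiff_id.add contDiff_const)
  have h1 := iteratedFDeriv_const_smul_apply (a := c s) (x := z)
    (h.of_le (m := k) (by exact_mod_cast le_top)).contDiffAt
  refine (congrArg norm h1).le.trans ?_
  rw [norm_smul, iteratedFDeriv_comp_add_right]
  exact mul_le_mul (hM s hs) (hC () _) (norm_nonneg _) ((norm_nonneg _).trans (hM s hs))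

theorem contDiff_shiftAverage_integrand {c : ℝ → ℂ} (hc : ContDiff ℝ ∞ c) {v : Plane → ℂ}
    (hv : ContDiff ℝ ∞ v) : ContDiff ℝ ∞ (Function.uncurry fun (s : ℝ) (z : Plane) ↦
      c s * v (z + s • EuclideanSpace.single 1 (1 : ℝ))) := by
  refine (hc.comp contDiff_fst).mul (hv.comp ?_)
  fun_prop

theorem unifBddDerivs_shiftAverage {b : ℝ} (hb : 0 ≤ b) {c : ℝ → ℂ} (hc : ContDiff ℝ ∞ c) {M : ℝ}
    (hM : ∀ s ∈ Set.Ioc 0 b, ‖c s‖ ≤ M) {v : Plane → ℂ} (hv : UnifBddDerivs fun _ : Unit ↦ v) :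
    UnifBddDerivs fun _ : Unit ↦ shiftAverage b c v := by
  choose C hC using exists_norm_iteratedFDeriv_shiftAverage_integrand_le hM hv
  simp only [funext fun z ↦ show shiftAverage b c v z = _ from intervalIntegral.integral_of_le hb]
  exact UnifBddDerivs.integral (fun _ ↦ contDiff_shiftAverage_integrand hc (hv.contDiff ()))
    (fun k ↦ integrable_const (C k)) fun _ k ↦ hC k

/-- For `c(s) = s`, the shift average of a function that is periodic in `y` is a primitive in `y`
of the function minus its mean, up to a factor. -/
theorem fderiv_shiftAverage_ofReal {b : ℝ} (hb : 0 ≤ b) {v : Plane → ℂ}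
    (hv : UnifBddDerivs fun _ : Unit ↦ v)
    (hper : ∀ z, v (z + b • EuclideanSpace.single 1 (1 : ℝ)) = v z) (z : Plane) :
    fderiv ℝ (shiftAverage b (fun s ↦ (s : ℂ)) v) z (EuclideanSpace.single 1 (1 : ℝ)) =
      b * v z - shiftAverage b 1 v z := by
  set e : Plane := EuclideanSpace.single 1 (1 : ℝ) with he
  have hM : ∀ s ∈ Set.Ioc 0 b, ‖(s : ℂ)‖ ≤ b := by
    intro s hs
    rw [Complex.norm_real, Real.norm_eq_abs, abs_of_pos hs.1]
    exact hs.2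
  have hvd : Differentiable ℝ v := (hv.contDiff ()).differentiable (by simp)
  have hsm := contDiff_shiftAverage_integrand Complex.ofRealCLM.contDiff (hv.contDiff ())
  obtain ⟨C₀, hC₀⟩ := exists_norm_iteratedFDeriv_shiftAverage_integrand_le hM hv 0
  obtain ⟨C₁, hC₁⟩ := exists_norm_iteratedFDeriv_shiftAverage_integrand_le hM hv 1
  have hd := hasFDerivAt_integral_of_contDiff (μ := volume.restrict (Set.Ioc 0 b)) hsm
    (integrable_const C₀) (integrable_const C₁) (by simpa using hC₀) (by simpa using hC₁) z
  have hint : Integrable (fun t : ℝ ↦ fderiv ℝ (fun z ↦ Complex.ofRealCLM t * v (z + t • e)) z)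
      (volume.restrict (Set.Ioc 0 b)) := by
    refine (integrable_const C₁).mono' ?_ (hC₁.mono fun t ht ↦ by simpa using ht z)
    exact (hsm.uncurry_fderiv_section.continuous.comp
      (by fun_prop : Continuous fun t : ℝ ↦ (t, z))).aestronglyMeasurable
  have hline : ∀ t : ℝ, HasDerivAt (fun t : ℝ ↦ v (z + t • e)) (fderiv ℝ v (z + t • e) e) t := by
    intro t
    have h1 : HasDerivAt (fun t : ℝ ↦ z + t • e) e t := by
      simpa using ((hasDerivAt_id t).smul_const e).const_add z
    exact (hvd _).hasFDerivAt.comp_hasDerivAt t h1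
  have hcont : Continuous fun t : ℝ ↦ fderiv ℝ v (z + t • e) e :=
    (((hv.contDiff ()).continuous_fderiv (by simp)).comp
      (by fun_prop : Continuous fun t : ℝ ↦ z + t • e)).clm_apply continuous_const
  have hfd : ∀ t : ℝ, fderiv ℝ (fun z ↦ Complex.ofRealCLM t * v (z + t • e)) z e =
      (t : ℂ) * fderiv ℝ v (z + t • e) e := by
    intro t
    have h1 : HasFDerivAt (fun z ↦ v (z + t • e)) (fderiv ℝ v (z + t • e)) z :=
      (hasFDerivAt_comp_add_right (t • e)).2 (hvd _).hasFDerivAt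
    rw [(h1.const_mul (Complex.ofRealCLM t)).fderiv]
    simp
  have hsa : shiftAverage b (fun s ↦ (s : ℂ)) v = fun z ↦ ∫ t, Complex.ofRealCLM t * v (z + t • e)
      ∂volume.restrict (Set.Ioc 0 b) := funext fun z ↦ intervalIntegral.integral_of_le hb
  rw [hsa, hd.fderiv, ContinuousLinearMap.integral_apply hint]
  simp_rw [hfd]
  -- Since ∂_y v(z + te) = ∂_t v(z + te), integrate by parts in t: periodicity turns the boundary
  -- term into b v(z), and the weight t differentiates to 1.
  rw [← intervalIntegral.integral_of_le hb, intervalIntegral.integral_mul_deriv_eq_deriv_mul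
    (u := fun t : ℝ ↦ (t : ℂ)) (u' := fun _ ↦ 1) (v := fun t : ℝ ↦ v (z + t • e))
    (fun t _ ↦ (hasDerivAt_id (t : ℂ)).comp_ofReal) (fun t _ ↦ hline t)
    (by simp) (hcont.intervalIntegrable _ _)]
  simp only [hper]
  simp [shiftAverage, he]

theorem shiftAverage_add {b : ℝ} {c : ℝ → ℂ} {v : Plane → ℂ} {ℓ : Plane}
    (h : ∀ z, v (z + ℓ) = v z) (z : Plane) : shiftAverage b c v (z + ℓ) = shiftAverage b c v z := by
  simp_rw [shiftAverage, add_right_comm z ℓ, h]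

theorem funD_add {i : Fin 2} {g : Plane → ℂ} {ℓ : Plane} (h : ∀ z, g (z + ℓ) = g z) (z : Plane) :
    funD i g (z + ℓ) = funD i g z := by
  rw [funD, ← fderiv_comp_add_right, funext h]
  rfl

end Averages

/-! ### The lattice in the adapted coordinates. -/

section Geometry

variable {A B : ℝ} {n m p q : ℤ}

theorem bLength_pos (hA : A ≠ 0) (hB : B ≠ 0) (hpq : n * q - m * p = 1) :
    0 < bLength A B n m := by
  refine Real.sqrt_pos.2 ?_
  rcases eq_or_ne n 0 with rfl | hn
  · have hm : (m : ℝ) ≠ 0 := by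
      rintro h
      obtain rfl : m = 0 := by exact_mod_cast h
      simp at hpq
    positivity
  · have : (n : ℝ) ≠ 0 := by exact_mod_cast hn
    positivity

theorem bLength_sq : bLength A B n m ^ 2 = (n : ℝ) ^ 2 * A ^ 2 + (m : ℝ) ^ 2 * B ^ 2 :=
  Real.sq_sqrt (by positivity)

variable {F : Plane ≃ₗᵢ[ℝ] Plane}

/-- This makes F^*V periodic in y with period b. -/
theorem IsAdapted.map_smul_single (hF : IsAdapted A B n m F) (hb : bLength A B n m ≠ 0) :
    F (bLength A B n m • EuclideanSpace.single 1 (1 : ℝ)) = latticeVec A B n m := by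
  have h : bLength A B n m • EuclideanSpace.single 1 (1 : ℝ) =
      (!₂[0, bLength A B n m] : Plane) := by
    ext i; fin_cases i <;> simp
  rw [h, hF, zero_smul, zero_add, xiZero, smul_smul, mul_inv_cancel₀ hb, one_smul]
  rfl

theorem IsAdapted.symm_latticeVec_zero (hF : IsAdapted A B n m F) (hb : bLength A B n m ≠ 0) :
    F.symm (latticeVec A B p q) 0 = aLength A B n m p q := by
  -- The coordinates are the inner products of (pA, qB) with Ξ₀^⊥ and Ξ₀.
  have h : F !₂[aLength A B n m p q,
      ((n : ℝ) * p * A ^ 2 + m * q * B ^ 2) / bLength A B n m] = latticeVec A B p q := by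
    have hb2 := bLength_sq (A := A) (B := B) (n := n) (m := m)
    rw [hF]
    ext i
    fin_cases i
    · simp [aLength, xiPerp, xiZero, latticeVec]
      field_simp
      rw [hb2]
      ring
    · simp [aLength, xiPerp, xiZero, latticeVec]
      field_simp
      rw [hb2]
      ring
  rw [← h, F.symm_apply_apply]
  simp

/-- The mean over a period does not depend on the starting point. In this form V₀ inherits
smoothness and lattice invariance from F^*V. -/
theorem orbitAverage_eq_shiftAverage {V : Plane → ℂ}
    (hper : ∀ z, (V ∘ F) (z + bLength A B n m • EuclideanSpace.single 1 (1 : ℝ)) = (V ∘ F) z)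
    (z : Plane) : orbitAverage (bLength A B n m) F V (z 0) =
      (bLength A B n m : ℂ)⁻¹ * shiftAverage (bLength A B n m) 1 (V ∘ F) z := by
  set b := bLength A B n m
  have hz : ∀ s : ℝ, z + s • EuclideanSpace.single 1 (1 : ℝ) = (!₂[z 0, s + z 1] : Plane) := by
    intro s
    ext i; fin_cases i <;> simp [add_comm]
  have hp : Function.Periodic (fun y : ℝ ↦ V (F !₂[z 0, y])) b := by
    intro y
    have := hper !₂[z 0, y]
    rw [show (!₂[z 0, y] : Plane) + b • EuclideanSpace.single 1 (1 : ℝ) = !₂[z 0, y + b] by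
      ext i; fin_cases i <;> simp] at this
    exact this
  rw [orbitAverage, shiftAverage]
  congr 1
  simp_rw [hz, Pi.one_apply, one_mul, Function.comp_apply]
  rw [intervalIntegral.integral_comp_add_right (fun y ↦ V (F !₂[z 0, y])) (z 1), zero_add,
    add_comm b, hp.intervalIntegral_add_eq (z 1) 0, zero_add]

end Geometry

/-! ### The conjugation identities in an abstract algebra. -/

section ConjugationAlgebra

variable {𝒜 : Type*} [Ring 𝒜] [Algebra ℂ 𝒜] {D V V₀ G w w' Ψ X : 𝒜} {h : ℂ}

/-- For w = [D, G] and w' = [D, w]. The h from hQ is grouped with D: hDΨX is a bounded frequency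
cutoff, so this term has size 1 and only the w' term gains h. -/
theorem conjugate_sq (h1 : G * (D * D) = D * D * G - (2 : ℂ) • (w * D) - w') (h2 : Commute D Ψ) :
    (1 + h • (G * Ψ)) * (D * D * X) = D * D * ((1 + h • (G * Ψ)) * X) +
      (-2 : ℂ) • (w * (h • D * (Ψ * X))) + h • ((-1 : ℂ) • (w' * Ψ) * X) := by
  have h3 : Ψ * (D * D) = D * D * Ψ := (h2.mul_left h2).eq.symm
  have h4 : G * Ψ * (D * D * X) = (D * D * G - (2 : ℂ) • (w * D) - w') * (Ψ * X) := by
    rw [← h1, ← mul_assoc, mul_assoc G, h3]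
    noncomm_ring
  rw [add_mul, smul_mul_assoc, h4]
  simp only [add_mul, sub_mul, mul_add, smul_mul_assoc, mul_smul_comm, smul_sub, smul_smul,
    one_mul, mul_assoc, neg_smul, neg_mul, one_smul]
  module

/-- The term wX is what the commutator with D_y² must cancel; commuting the potential past Q costs
only O(h). -/
theorem conjugate_potential (h4 : V = V₀ + w) :
    (1 + h • (G * Ψ)) * (V * X) = V₀ * ((1 + h • (G * Ψ)) * X) + w * X +
      h • ((G * (Ψ * V) + (-1 : ℂ) • (V₀ * (G * Ψ))) * X) := by
  subst h4
  simp only [add_mul, mul_add, smul_mul_assoc, mul_smul_comm, smul_add, smul_smul, one_mul,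
    mul_assoc]
  module

end ConjugationAlgebra

/-! ### The operators Q, W and R as quantizations. -/

section SymbolConstruction

theorem UnifBddDerivs.comp_clm {κ E E' : Type} [NormedAddCommGroup E] [NormedSpace ℝ E]
    [NormedAddCommGroup E'] [NormedSpace ℝ E'] {g : E → ℂ} (hg : UnifBddDerivs fun _ : Unit ↦ g)
    (L : E' →L[ℝ] E) : UnifBddDerivs fun (_ : κ) (x : E') ↦ g (L x) := by
  simpa using hg.comp_affine (κ := κ) (fun _ ↦ ()) (fun _ ↦ 0) (fun _ ↦ L) fun _ ↦ le_rfl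

theorem HasCompactSupport.exists_eq_zero_of_lt_norm {E : Type*} [NormedAddCommGroup E] {f : E → ℂ}
    (hf : HasCompactSupport f) : ∃ M : ℝ, ∀ x, M < ‖x‖ → f x = 0 := by
  obtain ⟨M, hM⟩ := hf.isCompact.isBounded.exists_norm_le
  exact ⟨M, fun x hx ↦ image_eq_zero_of_notMem_tsupport fun h ↦ (hM x h).not_gt hx⟩

theorem HasPointwiseSymbol.cutoffOp {χ : Plane → ℂ} (hχ : χ.HasTemperateGrowth) (h : ℝ) :
    HasPointwiseSymbol h (fun _ ζ ↦ χ ζ) (cutoffOp χ h) := by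
  have := HasPointwiseSymbol.one.comp_cutoffOp (h := h) (hχ.comp_const_smul _)
  simp_rw [one_mul] at this
  exact this

theorem ContDiff.hasTemperateGrowth_coord {ψ : ℝ → ℂ} (hψ : ContDiff ℝ ∞ ψ)
    (hψc : HasCompactSupport ψ) (i : Fin 2) :
    (fun ζ : Plane ↦ ψ (ζ i)).HasTemperateGrowth :=
  (hψc.hasTemperateGrowth hψ).comp (EuclideanSpace.proj (𝕜 := ℝ) i).hasTemperateGrowth

theorem isTangentialPsiZero_mulOp_mul_cutoffOp {ψ : ℝ → ℂ} (hψ : ContDiff ℝ ∞ ψ)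
    (hψc : HasCompactSupport ψ) {g : Plane → ℂ} (hg : UnifBddDerivs fun _ : Unit ↦ g) :
    IsTangentialPsiZero fun h ↦ mulOp g * _root_.cutoffOp (fun ζ ↦ ψ (ζ 1)) h := by
  obtain ⟨M, hM⟩ := hψc.exists_eq_zero_of_lt_norm
  refine ⟨fun z η ↦ g z * ψ η, ?_, fun h _ ↦ ?_⟩
  · exact ((hg.comp_clm (ContinuousLinearMap.fst ℝ Plane ℝ)).mul
      ((UnifBddDerivs.of_hasCompactSupport hψ hψc).comp_clm
        (ContinuousLinearMap.snd ℝ Plane ℝ))).isSymbolZero (M := M)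
          fun h _ z η hη ↦ by simp [hM η hη]
  · exact ((HasPointwiseSymbol.cutoffOp (hψ.hasTemperateGrowth_coord hψc 1) h).mulOp_comp
      (hg.hasTemperateGrowth ())).isQuantization

theorem isPsiZeroVanishing_mulOp_mul_cutoffOp {ψ θ : ℝ → ℂ} (hψ : ContDiff ℝ ∞ ψ)
    (hψc : HasCompactSupport ψ) (hθ : ContDiff ℝ ∞ θ) (hθc : HasCompactSupport θ) (hθ0 : θ 0 = 0)
    {g : Plane → ℂ} (hg : UnifBddDerivs fun _ : Unit ↦ g) (c : ℂ) :
    IsPsiZeroVanishing fun h ↦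
      c • (mulOp g * _root_.cutoffOp (fun ζ ↦ θ (ζ 0) * ψ (ζ 1)) h) := by
  obtain ⟨M, hM⟩ := hψc.exists_eq_zero_of_lt_norm
  obtain ⟨M', hM'⟩ := hθc.exists_eq_zero_of_lt_norm
  refine ⟨fun z ζ ↦ c * (g z * (θ (ζ 0) * ψ (ζ 1))), ?_, fun h _ ↦ ?_, fun z ζ hζ ↦ ?_⟩
  · refine (((hg.comp_clm (ContinuousLinearMap.fst ℝ Plane Plane)).mul
      (((UnifBddDerivs.of_hasCompactSupport hθ hθc).comp_clm (EuclideanSpace.proj (0 : Fin 2) ∘L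
        ContinuousLinearMap.snd ℝ Plane Plane)).mul
      ((UnifBddDerivs.of_hasCompactSupport hψ hψc).comp_clm (EuclideanSpace.proj (1 : Fin 2) ∘L
        ContinuousLinearMap.snd ℝ Plane Plane)))).const_mul c).isSymbolZero (M := |M'| + |M|)
          fun h _ z ζ hζ ↦ ?_
    rcases lt_or_ge M' ‖ζ 0‖ with h0 | h0
    · simp [hM' _ h0]
    rcases lt_or_ge M ‖ζ 1‖ with h1 | h1
    · simp [hM _ h1]
    refine absurd hζ (not_lt.2 ?_)
    rw [EuclideanSpace.norm_eq, Fin.sum_univ_two]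
    refine Real.sqrt_le_iff.2 ⟨by positivity, ?_⟩
    nlinarith [norm_nonneg (ζ 0), norm_nonneg (ζ 1), h0.trans (le_abs_self M'),
      h1.trans (le_abs_self M)]
  · exact (((HasPointwiseSymbol.cutoffOp ((hθ.hasTemperateGrowth_coord hθc 0).mul
      (hψ.hasTemperateGrowth_coord hψc 1)) h).mulOp_comp
      (hg.hasTemperateGrowth ())).smul c).isQuantization
  · simp [hζ, hθ0]

/-- The operators `(g₁ ψ(hD_y) v + g₂ ψ(hD_y)) χ(hD)` form a family in `Ψ⁰`. -/
theorem isPsiZero_remainder {ψ : ℝ → ℂ} (hψ : ContDiff ℝ ∞ ψ) (hψc : HasCompactSupport ψ)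
    {χ : Plane → ℂ} (hχ : ContDiff ℝ ∞ χ) (hχc : HasCompactSupport χ) {g₁ g₂ v : Plane → ℂ}
    (hg₁ : UnifBddDerivs fun _ : Unit ↦ g₁) (hg₂ : UnifBddDerivs fun _ : Unit ↦ g₂)
    (hv : UnifBddDerivs fun _ : Unit ↦ v) :
    IsPsiZero fun h ↦ (mulOp g₁ * (_root_.cutoffOp (fun ζ ↦ ψ (ζ 1)) h * mulOp v) +
      mulOp g₂ * _root_.cutoffOp (fun ζ ↦ ψ (ζ 1)) h) * _root_.cutoffOp χ h := by
  obtain ⟨K, hK⟩ := exists_schwartz_kernel hψ hψc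
  obtain ⟨M, hM⟩ := hχc.exists_eq_zero_of_lt_norm
  obtain ⟨C, hC⟩ := hv.exists_norm_le
  have hψt := hψ.hasTemperateGrowth_coord hψc 1
  -- The factor χ gives compact support in ζ, so bounded derivatives suffice; h enters only through
  -- `compSymbol`.
  refine ⟨fun h z ζ ↦ (g₁ z * compSymbol K v h z ζ + g₂ z * ψ (ζ 1)) * χ ζ, ?_, fun h _ ↦ ?_⟩
  · refine ((((hg₁.comp_clm (ContinuousLinearMap.fst ℝ Plane Plane)).mul
      (unifBddDerivs_compSymbol K hv)).add
      ((hg₂.comp_clm (ContinuousLinearMap.fst ℝ Plane Plane)).mul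
      ((UnifBddDerivs.of_hasCompactSupport hψ hψc).comp_clm (EuclideanSpace.proj (1 : Fin 2) ∘L
        ContinuousLinearMap.snd ℝ Plane Plane)))).mul
      ((UnifBddDerivs.of_hasCompactSupport hχ hχc).comp_clm
        (ContinuousLinearMap.snd ℝ Plane Plane))).isSymbolZero (M := M)
          fun h _ z ζ hζ ↦ by simp [hM ζ hζ]
  · exact ((((hasPointwiseSymbol_cutoffOp_comp_mulOp hK (hψt.comp_const_smul _)
      (hv.hasTemperateGrowth ()) (hC ())).mulOp_comp (hg₁.hasTemperateGrowth ())).add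
      ((HasPointwiseSymbol.cutoffOp hψt h).mulOp_comp (hg₂.hasTemperateGrowth ()))).comp_cutoffOp
      ((hχc.hasTemperateGrowth hχ).comp_const_smul _)).isQuantization

end SymbolConstruction

section MulOpAlgebra

variable {f g : Plane → ℂ}

theorem mulOp_add (hf : f.HasTemperateGrowth) (hg : g.HasTemperateGrowth) :
    mulOp (fun z ↦ f z + g z) = mulOp f + mulOp g :=
  TemperedDistribution.smulLeftCLM_add hf hg

theorem mulOp_mul (hf : f.HasTemperateGrowth) (hg : g.HasTemperateGrowth) :
    mulOp (fun z ↦ f z * g z) = mulOp f * mulOp g := by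
  refine Eq.trans ?_ (TemperedDistribution.smulLeftCLM_compL_smulLeftCLM hg hf).symm
  rw [mul_comm]
  rfl

theorem mulOp_const_mul (hg : g.HasTemperateGrowth) (c : ℂ) :
    mulOp (fun z ↦ c * g z) = c • mulOp g :=
  TemperedDistribution.smulLeftCLM_smul hg c

end MulOpAlgebra

theorem proposition2p3
    (A B : ℝ) (hA : A ≠ 0) (hB : B ≠ 0)
    (n m p q : ℤ) (hpq : n * q - m * p = 1)
    (F : Plane ≃ₗᵢ[ℝ] Plane) (hF : IsAdapted A B n m F)
    (V : Plane → ℂ) (hV : ContDiff ℝ ∞ V)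
    (hVper : ∀ (j k : ℤ) (z : Plane), V (z + latticeVec A B j k) = V z)
    (V₀ : ℝ → ℂ) (hV₀ : V₀ = orbitAverage (bLength A B n m) F V)
    (χ : Plane → ℂ) (hχ : ContDiff ℝ ∞ χ) (hχc : HasCompactSupport χ)
    (hχ0 : ∀ᶠ ζ in 𝓝ˢ {ζ : Plane | ζ 1 = 0}, χ ζ = 0) :
    (∀ (x : ℝ) (k : ℤ), V₀ (x + k * aLength A B n m p q) = V₀ x) ∧
    ∃ Q : ℝ → PlaneOp,
      IsTangentialPsiZero Q ∧
      (∀ h ∈ Set.Ioc (0 : ℝ) 1, PreservesPeriodicity A B (conjOp F (Q h))) ∧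
      (∃ R : ℝ → PlaneOp,
        IsPsiZero R ∧
        (∀ h ∈ Set.Ioc (0 : ℝ) 1, PreservesPeriodicity A B (conjOp F (R h))) ∧
        ∀ h ∈ Set.Ioc (0 : ℝ) 1,
          (1 + (h : ℂ) • Q h) ∘L (diffD 1 ∘L diffD 1 + mulOp (V ∘ F)) ∘L cutoffOp χ h =
            (diffD 1 ∘L diffD 1 + mulOp (fun z ↦ V₀ (z 0))) ∘L (1 + (h : ℂ) • Q h) ∘L
                cutoffOp χ h
              + (h : ℂ) • R h) ∧
      (∃ W R : ℝ → PlaneOp,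
        IsPsiZeroVanishing W ∧
        IsPsiZero R ∧
        (∀ h ∈ Set.Ioc (0 : ℝ) 1, PreservesPeriodicity A B (conjOp F (W h))) ∧
        (∀ h ∈ Set.Ioc (0 : ℝ) 1, PreservesPeriodicity A B (conjOp F (R h))) ∧
        ∀ h ∈ Set.Ioc (0 : ℝ) 1,
          (1 + (h : ℂ) • Q h) ∘L
                (diffD 0 ∘L diffD 0 + diffD 1 ∘L diffD 1 + mulOp (V ∘ F)) ∘L cutoffOp χ h =
            ((diffD 0 ∘L diffD 0 + diffD 1 ∘L diffD 1 + mulOp (fun z ↦ V₀ (z 0))) ∘L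
                  (1 + (h : ℂ) • Q h) + W h) ∘L cutoffOp χ h
              + (h : ℂ) • R h) := by
  set b := bLength A B n m with hb
  have hbpos : 0 < b := bLength_pos hA hB hpq
  have hbC : (b : ℂ) ≠ 0 := by exact_mod_cast hbpos.ne'
  have hVb : UnifBddDerivs fun _ : Unit ↦ V := unifBddDerivs_of_periodic hA hB hV hVper
  have hv : UnifBddDerivs fun _ : Unit ↦ V ∘ F :=
    hVb.comp_clm (F.toContinuousLinearEquiv : Plane →L[ℝ] Plane)
  have hvper : ∀ (j k : ℤ) (z : Plane), (V ∘ F) (z + F.symm (latticeVec A B j k)) = (V ∘ F) z := by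
    intro j k z
    simp [hVper]
  have hvb : ∀ z, (V ∘ F) (z + b • EuclideanSpace.single 1 (1 : ℝ)) = (V ∘ F) z := by
    intro z
    rw [← hvper n m z, ← hF.map_smul_single hbpos.ne', F.symm_apply_apply]
  have hV₀z : (fun z : Plane ↦ V₀ (z 0)) = fun z ↦ (b : ℂ)⁻¹ * shiftAverage b 1 (V ∘ F) z := by
    rw [hV₀]
    exact funext fun z ↦ orbitAverage_eq_shiftAverage hvb z
  have hV₀per : ∀ (j k : ℤ) (z : Plane),
      V₀ ((z + F.symm (latticeVec A B j k)) 0) = V₀ (z 0) := by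
    intro j k z
    have h1 := congrFun hV₀z
    beta_reduce at h1
    rw [h1, h1, shiftAverage_add (hvper j k)]
  have hV₀b : UnifBddDerivs fun (_ : Unit) (z : Plane) ↦ V₀ (z 0) := by
    rw [hV₀z]
    exact (unifBddDerivs_shiftAverage hbpos.le contDiff_const (M := ‖(1 : ℂ)‖)
      (fun _ _ ↦ le_rfl) hv).const_mul _
  refine ⟨fun x k ↦ ?_, ?_⟩
  -- The lattice vector k(pA, qB) advances x by exactly ka.
  · have h1 := hV₀per (k * p) (k * q) !₂[x, 0]
    have h2 : latticeVec A B (k * p) (k * q) = (k : ℝ) • latticeVec A B p q := by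
      ext i; fin_cases i <;> simp [latticeVec, mul_assoc]
    rw [h2, map_smul] at h1
    simpa [hF.symm_latticeVec_zero hbpos.ne'] using h1
  -- The factor i cancels the -i in D_y, and 1/b normalizes the mean, so that D_y g = v - V₀.
  set g : Plane → ℂ := fun z ↦
    (Complex.I / b) * shiftAverage b (fun s ↦ (s : ℂ)) (V ∘ F) z with hg_def
  have hsa : UnifBddDerivs fun _ : Unit ↦ shiftAverage b (fun s ↦ (s : ℂ)) (V ∘ F) := by
    refine unifBddDerivs_shiftAverage hbpos.le Complex.ofRealCLM.contDiff (M := b) ?_ hv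
    intro s hs
    rw [Complex.ofRealCLM_apply, Complex.norm_real, Real.norm_eq_abs, abs_of_pos hs.1]
    exact hs.2
  have hg : UnifBddDerivs fun _ : Unit ↦ g := hsa.const_mul _
  have hgper : ∀ (j k : ℤ) (z : Plane), g (z + F.symm (latticeVec A B j k)) = g z := by
    intro j k z
    simp only [hg_def, shiftAverage_add (hvper j k)]
  set w : Plane → ℂ := funD 1 g with hw_def
  have hw : UnifBddDerivs fun _ : Unit ↦ w := hg.funD 1
  have hvw : V ∘ F = fun z ↦ V₀ (z 0) + w z := by
    ext z
    have h1 := congrFun hV₀z z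
    beta_reduce at h1
    have h2 : HasFDerivAt g ((Complex.I / b) •
        fderiv ℝ (shiftAverage b (fun s ↦ (s : ℂ)) (V ∘ F)) z) z :=
      ((((hsa.contDiff ()).differentiable (by simp)) z).hasFDerivAt).const_mul _
    rw [h1, hw_def, funD, h2.fderiv, smul_apply, fderiv_shiftAverage_ofReal hbpos.le hv hvb,
      smul_eq_mul]
    field_simp
    linear_combination
      (b * (V ∘ F) z - shiftAverage b 1 (V ∘ F) z) * Complex.I_mul_I
  obtain ⟨c, M, hc, hcM, hsupp⟩ := exists_bounds_of_vanishing_near_line hχc hχ0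
  obtain ⟨ψ, hψ, hψc, hψ1⟩ := exists_smooth_half_inv hc hcM
  obtain ⟨θ, hθ, hθc, hθ0, hθ1⟩ := exists_smooth_coord (hc.trans hcM)
  have hχt : χ.HasTemperateGrowth := hχc.hasTemperateGrowth hχ
  have hψt := hψ.hasTemperateGrowth_coord hψc 1
  have hθψt : (fun ζ : Plane ↦ θ (ζ 0) * ψ (ζ 1)).HasTemperateGrowth :=
    (hθ.hasTemperateGrowth_coord hθc 0).mul hψt
  have hψχt : (fun ζ : Plane ↦ ψ (ζ 1) * χ ζ).HasTemperateGrowth := hψt.mul hχt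
  set Ψ : ℝ → PlaneOp := cutoffOp (fun ζ ↦ ψ (ζ 1)) with hΨ
  have hgt := hg.hasTemperateGrowth ()
  have hV₀t := hV₀b.hasTemperateGrowth ()
  have hw't := (hw.funD 1).hasTemperateGrowth ()
  have hgxxt := ((hg.funD 0).funD 0).hasTemperateGrowth ()
  -- These coefficients collect the O(h) terms left of ψ(hD_y): -V₀g from the potential, -D_y² g
  -- from D_y², and for (ii) also -D_x² g.
  set k₁ : Plane → ℂ := fun z ↦ (-1) * (V₀ (z 0) * g z) + (-1) * funD 1 w z with hk₁_def
  set k₂ : Plane → ℂ := fun z ↦ k₁ z + (-1) * funD 0 (funD 0 g) z with hk₂_def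
  have hk₁ : UnifBddDerivs fun _ : Unit ↦ k₁ :=
    ((hV₀b.mul hg).const_mul _).add ((hw.funD 1).const_mul _)
  have hk₂ : UnifBddDerivs fun _ : Unit ↦ k₂ := hk₁.add (((hg.funD 0).funD 0).const_mul _)
  have hk₁op : mulOp k₁ =
      (-1 : ℂ) • (mulOp (fun z ↦ V₀ (z 0)) * mulOp g) + (-1 : ℂ) • mulOp (funD 1 w) := by
    rw [← mulOp_mul hV₀t hgt, ← mulOp_const_mul ((hV₀b.mul hg).hasTemperateGrowth ()),
      ← mulOp_const_mul hw't]
    exact mulOp_add (((hV₀b.mul hg).const_mul _).hasTemperateGrowth ())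
      (((hw.funD 1).const_mul _).hasTemperateGrowth ())
  have hk₂op : mulOp k₂ = mulOp k₁ + (-1 : ℂ) • mulOp (funD 0 (funD 0 g)) := by
    rw [← mulOp_const_mul hgxxt]
    exact mulOp_add (hk₁.hasTemperateGrowth ())
      ((((hg.funD 0).funD 0).const_mul _).hasTemperateGrowth ())
  have hcomm : ∀ (j k : ℤ) {f : Plane → ℂ}, UnifBddDerivs (fun _ : Unit ↦ f) →
      (∀ (j k : ℤ) (z : Plane), f (z + F.symm (latticeVec A B j k)) = f z) →
      Commute (translationOp (F.symm (latticeVec A B j k))) (mulOp f) := fun j k f hf hper ↦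
    commute_translationOp_mulOp (hf.hasTemperateGrowth ()) (hper j k)
  have hcommΨ : ∀ (h : ℝ) (ℓ : Plane), Commute (translationOp ℓ) (Ψ h) := fun h ℓ ↦
    commute_translationOp_cutoffOp (hψt.comp_const_smul _) ℓ
  have hcommχ : ∀ (h : ℝ) (ℓ : Plane), Commute (translationOp ℓ) (cutoffOp χ h) := fun h ℓ ↦
    commute_translationOp_cutoffOp (hχt.comp_const_smul _) ℓ
  have hk₁per : ∀ (j k : ℤ) (z : Plane), k₁ (z + F.symm (latticeVec A B j k)) = k₁ z := by
    intro j k z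
    simp only [hk₁_def, hw_def, hV₀per, hgper, funD_add (funD_add (hgper j k))]
  have hk₂per : ∀ (j k : ℤ) (z : Plane), k₂ (z + F.symm (latticeVec A B j k)) = k₂ z := by
    intro j k z
    simp only [hk₂_def, hk₁per, funD_add (funD_add (hgper j k))]
  have hΨχ : ∀ h : ℝ, (h : ℂ) • diffD 1 * (Ψ h * cutoffOp χ h) = (2 : ℂ)⁻¹ • cutoffOp χ h := by
    intro h
    rw [smul_diffD_eq_cutoffOp, hΨ, cutoffOp_mul_cutoffOp hψt hχt,
      cutoffOp_mul_cutoffOp (hasTemperateGrowth_coord 1) hψχt, cutoffOp, cutoffOp,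
      ← TemperedDistribution.fourierMultiplierCLM_smul (hχt.comp_const_smul _)]
    congr 1
    ext y
    simp only [Pi.smul_apply, smul_eq_mul]
    generalize (2 * Real.pi * h) • y = ζ
    by_cases hζ : χ ζ = 0
    · simp [hζ]
    · obtain ⟨h2, h3⟩ := hsupp ζ hζ
      have h4 := hψ1 (ζ 1) h2 ((PiLp.norm_apply_le ζ 1).trans h3)
      -- On supp χ, 2ηψ(η) = 1; off it both sides vanish.
      linear_combination (χ ζ / 2) * h4
  have hθχ : ∀ h : ℝ, (h : ℂ) • diffD 0 * (Ψ h * cutoffOp χ h) =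
      cutoffOp (fun ζ ↦ θ (ζ 0) * ψ (ζ 1)) h * cutoffOp χ h := by
    intro h
    rw [smul_diffD_eq_cutoffOp, hΨ, cutoffOp_mul_cutoffOp hψt hχt,
      cutoffOp_mul_cutoffOp (hasTemperateGrowth_coord 0) hψχt,
      cutoffOp_mul_cutoffOp hθψt hχt]
    congr 1
    ext ζ
    by_cases hζ : χ ζ = 0
    · simp [hζ]
    · rw [hθ1 _ ((PiLp.norm_apply_le ζ 0).trans (hsupp ζ hζ).2), mul_assoc]
  have hVop : mulOp (V ∘ F) = mulOp (fun z ↦ V₀ (z 0)) + mulOp w := by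
    conv_lhs => rw [hvw]
    exact mulOp_add hV₀t (hw.hasTemperateGrowth ())
  have hone : ∀ h ∈ Set.Ioc (0 : ℝ) 1,
      (1 + (h : ℂ) • (mulOp g * Ψ h)) * ((diffD 1 * diffD 1 + mulOp (V ∘ F)) * cutoffOp χ h) =
        (diffD 1 * diffD 1 + mulOp (fun z ↦ V₀ (z 0))) *
          ((1 + (h : ℂ) • (mulOp g * Ψ h)) * cutoffOp χ h) +
        (h : ℂ) • ((mulOp g * (Ψ h * mulOp (V ∘ F)) + mulOp k₁ * Ψ h) * cutoffOp χ h) := by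
    intro h hh
    -- By `hΨχ` the commutator term is -2 · w · ½χ(hD), which cancels the wχ(hD) of
    -- `conjugate_potential`.
    rw [add_mul (diffD 1 * diffD 1), mul_add,
      conjugate_sq (mulOp_mul_diffD_mul_diffD hg 1) (commute_diffD_cutoffOp hψt 1 hh.1.ne'),
      conjugate_potential hVop, hΨχ, hk₁op, ← hw_def]
    simp only [add_mul, smul_mul_assoc, mul_smul_comm, smul_add, smul_smul, mul_assoc]
    module
  have hzero : ∀ h ∈ Set.Ioc (0 : ℝ) 1,
      (1 + (h : ℂ) • (mulOp g * Ψ h)) * (diffD 0 * diffD 0 * cutoffOp χ h) =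
        diffD 0 * diffD 0 * ((1 + (h : ℂ) • (mulOp g * Ψ h)) * cutoffOp χ h) +
        (-2 : ℂ) • (mulOp (funD 0 g) * cutoffOp (fun ζ ↦ θ (ζ 0) * ψ (ζ 1)) h) * cutoffOp χ h +
        (h : ℂ) • ((-1 : ℂ) • (mulOp (funD 0 (funD 0 g)) * Ψ h) * cutoffOp χ h) := by
    -- Here hD_xψ(hD_y) is not a multiple of the identity on supp χ, so the first-order term stays
    -- and becomes W.
    intro h hh
    rw [conjugate_sq (mulOp_mul_diffD_mul_diffD hg 0) (commute_diffD_cutoffOp hψt 0 hh.1.ne'),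
      hθχ]
    simp only [smul_mul_assoc, mul_assoc, hΨ]
  refine ⟨fun h ↦ mulOp g * Ψ h, isTangentialPsiZero_mulOp_mul_cutoffOp hψ hψc hg,
    fun h _ ↦ preservesPeriodicity_conjOp fun j k ↦ (hcomm j k hg hgper).mul_right (hcommΨ h _),
    ⟨_, isPsiZero_remainder hψ hψc hχ hχc hg hk₁ hv, fun h _ ↦ preservesPeriodicity_conjOp
      fun j k ↦ (((hcomm j k hg hgper).mul_right ((hcommΨ h _).mul_right
        (hcomm j k hv hvper))).add_right ((hcomm j k hk₁ hk₁per).mul_right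
          (hcommΨ h _))).mul_right (hcommχ h _), hone⟩,
    ⟨_, _, isPsiZeroVanishing_mulOp_mul_cutoffOp hψ hψc hθ hθc hθ0 (hg.funD 0) (-2),
      isPsiZero_remainder hψ hψc hχ hχc hg hk₂ hv, fun h _ ↦ preservesPeriodicity_conjOp
      fun j k ↦ ((hcomm j k (hg.funD 0) fun j k ↦ funD_add (hgper j k)).mul_right
        (commute_translationOp_cutoffOp (hθψt.comp_const_smul _) _)).smul_right _,
      fun h _ ↦ preservesPeriodicity_conjOp
      fun j k ↦ (((hcomm j k hg hgper).mul_right ((hcommΨ h _).mul_right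
        (hcomm j k hv hvper))).add_right ((hcomm j k hk₂ hk₂per).mul_right
          (hcommΨ h _))).mul_right (hcommχ h _), fun h hh ↦ ?_⟩⟩
  have h1 := hone h hh
  have h0 := hzero h hh
  simp only [← ContinuousLinearMap.mul_def]
  have e1 : (diffD 0 * diffD 0 + diffD 1 * diffD 1 + mulOp (V ∘ F)) * cutoffOp χ h =
      diffD 0 * diffD 0 * cutoffOp χ h + (diffD 1 * diffD 1 + mulOp (V ∘ F)) * cutoffOp χ h := by
    rw [add_assoc, add_mul]
  rw [e1, mul_add, h0, h1, hk₂op]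
  simp only [add_mul, smul_mul_assoc, smul_add, mul_assoc]
  abel
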